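/- Let $1\le p\le\infty$ and let $N$ be a natural number. **Definitions.** For $x\in\mathbb R^N$, $\varepsilon>0$ and a real function $v$ that is continuous on the closed ball $\overline{B_\varepsilon(x)}$, let $\mu_p(\varepsilon,v)(x)$ be the unique real number $\mu$ with $$\|v-\mu\|_{L^p(\overline{B_\varepsilon(x)})}=\min_{\lambda\in\mathbb R}\|v-\lambda\|_{L^p(\overline{B_\varepsilon(x)})}$$ (Lebesgue measure). For $\phi$ of class $C^2$ near $x$ with $\nabla\phi(x)\ne0$ let $$\Delta_p^n\phi(x)=\frac{\nabla\cdot(|\nabla\phi|^{p-2}\nabla\phi)(x)}{|\nabla\phi(x)|^{p-2}}\quad(1\le p<\infty),\qquad \Delta_\infty^n\phi(x)=\frac{\langle\nabla^2\phi(x)\nabla\phi(x),\nabla\phi(x)\rangle}{|\nabla\phi(x)|^2}.$$ Let $\Omega\subseteq\mathbb R^N$ be open, $u\in C(\Omega)$ and $x\in\Omega$. A function $\phi$ of class $C^2$ near $x$ with $\phi(x)=u(x)$ and $\nabla\phi(x)\neq0$ touches $u$ at $x$ from below (from above) if $u-\phi$ has a strict local minimum (maximum) at $x$. - $u$ is a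 *viscosity solution of $\Delta_p^n u=0$ in $\Omega$* if for every $x\in\Omega$: $\Delta_p^n\phi(x)\le0$ for every $\phi$ touching $u$ at $x$ from below, and $\Delta_p^n\phi(x)\ge0$ for every $\phi$ touching $u$ at $x$ from above. - *$u(x)=\mu_p(\varepsilon,u)(x)+o(\varepsilon^2)$ as $\varepsilon\to0^+$ in the viscosity sense at $x$* if $\phi(x)\ge\mu_p(\varepsilon,\phi)(x)+o(\varepsilon^2)$ as $\varepsilon\to0^+$ for every $\phi$ touching $u$ at $x$ from below, and $\phi(x)\le\mu_p(\varepsilon,\phi)(x)+o(\varepsilon^2)$ as $\varepsilon\to0^+$ for every $\phi$ touching $u$ at $x$ from above. **Theorem.** The number $\mu_p(\varepsilon,v)(x)$ is well defined: for all $x\in\mathbb R^N$, $\varepsilon>0$ and $v\in C(\overline{B_\varepsilon(x)})$ the minimizer above exists and is unique. Moreover, for every open $\Omega\subseteq\mathbb R^N$ and every $u\in C(\Omega)$ the following are equivalent: 1. $u$ is a viscosity solution of $\Delta_p^nu=0$ in $\Omega$; 2. $u(x)=\mu_p(\varepsilon,u)(x)+o(\varepsilon^2)$ as $\varepsilon\to0^+$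 in the viscosity sense at every $x\in\Omega$. -/

import Mathlib

open Filter Topology MeasureTheory Asymptotics
open scoped ENNReal

/-- The divergence of a vector field on `ℝ^N`: the sum of the partial derivatives `∂ᵢ Fᵢ`. -/
noncomputable def divergence {N : ℕ}
    (F : EuclideanSpace ℝ (Fin N) → EuclideanSpace ℝ (Fin N)) (x : EuclideanSpace ℝ (Fin N)) : ℝ :=
  ∑ i : Fin N, (fderiv ℝ F x (EuclideanSpace.single i 1)) i

open Classical in
/-- The normalized `p`-Laplacian, `1 ≤ p ≤ ∞`:
`div (|∇φ|^(p-2) ∇φ) / |∇φ|^(p-2)` for finite `p` and `⟨∇²φ ∇φ, ∇φ⟩ / |∇φ|²` for `p = ∞`.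
It is only used at points where `φ` is `C²` and `∇φ ≠ 0`. -/
noncomputable def normalizedPLaplacian {N : ℕ} (p : ℝ≥0∞)
    (φ : EuclideanSpace ℝ (Fin N) → ℝ) (x : EuclideanSpace ℝ (Fin N)) : ℝ :=
  if p = ∞ then
    inner ℝ (fderiv ℝ (gradient φ) x (gradient φ x)) (gradient φ x) / ‖gradient φ x‖ ^ 2
  else
    divergence (fun y => ‖gradient φ y‖ ^ (p.toReal - 2) • gradient φ y) x
      / ‖gradient φ x‖ ^ (p.toReal - 2)

/-- `m` minimizes `l ↦ ‖u - l‖` in `L^p` of the closed ball of radius `ε` about `x`,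
over all real constants `l`. -/
def IsPMean {N : ℕ} (p : ℝ≥0∞) (ε : ℝ) (u : EuclideanSpace ℝ (Fin N) → ℝ)
    (x : EuclideanSpace ℝ (Fin N)) (m : ℝ) : Prop :=
  ∀ l : ℝ, eLpNorm (fun y => u y - m) p (volume.restrict (Metric.closedBall x ε))
    ≤ eLpNorm (fun y => u y - l) p (volume.restrict (Metric.closedBall x ε))

/-- The `p`-mean `μ_p(ε, u)(x)`: the minimizing constant (it is unique for `ε > 0` and `u`
continuous on the closed ball). -/
noncomputable def pMean {N : ℕ} (p : ℝ≥0∞) (ε : ℝ) (u : EuclideanSpace ℝ (Fin N) → ℝ)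
    (x : EuclideanSpace ℝ (Fin N)) : ℝ :=
  Classical.epsilon (IsPMean p ε u x)

/-- `φ` is an admissible test function touching `u` at `x` from below: it is `C²` near `x`,
`u - φ` has a strict (local) minimum at `x`, `u x = φ x` and `∇φ(x) ≠ 0`. -/
structure TouchesFromBelow {N : ℕ} (φ u : EuclideanSpace ℝ (Fin N) → ℝ)
    (x : EuclideanSpace ℝ (Fin N)) : Prop where
  contDiffAt : ContDiffAt ℝ 2 φ x
  strictMin : ∀ᶠ y in 𝓝[≠] x, u x - φ x < u y - φ y
  eq : u x = φ x
  gradient_ne_zero : gradient φ x ≠ 0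

/-- `φ` is an admissible test function touching `u` at `x` from above: it is `C²` near `x`,
`u - φ` has a strict (local) maximum at `x`, `u x = φ x` and `∇φ(x) ≠ 0`. -/
structure TouchesFromAbove {N : ℕ} (φ u : EuclideanSpace ℝ (Fin N) → ℝ)
    (x : EuclideanSpace ℝ (Fin N)) : Prop where
  contDiffAt : ContDiffAt ℝ 2 φ x
  strictMax : ∀ᶠ y in 𝓝[≠] x, u y - φ y < u x - φ x
  eq : u x = φ x
  gradient_ne_zero : gradient φ x ≠ 0

/-- `u` (assumed continuous on `Ω`) is a viscosity solution of the normalized `p`-Laplace equation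
in `Ω`. -/
def IsViscositySolution {N : ℕ} (p : ℝ≥0∞) (Ω : Set (EuclideanSpace ℝ (Fin N)))
    (u : EuclideanSpace ℝ (Fin N) → ℝ) : Prop :=
  ∀ x ∈ Ω,
    (∀ φ : EuclideanSpace ℝ (Fin N) → ℝ, TouchesFromBelow φ u x →
      normalizedPLaplacian p φ x ≤ 0) ∧
    (∀ φ : EuclideanSpace ℝ (Fin N) → ℝ, TouchesFromAbove φ u x →
      0 ≤ normalizedPLaplacian p φ x)

/-- `u(x) = μ_p(ε,u)(x) + o(ε²)` as `ε → 0⁺`, in the viscosity sense at the point `x`. -/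
def ViscosityAMVP {N : ℕ} (p : ℝ≥0∞) (u : EuclideanSpace ℝ (Fin N) → ℝ)
    (x : EuclideanSpace ℝ (Fin N)) : Prop :=
  (∀ φ : EuclideanSpace ℝ (Fin N) → ℝ, TouchesFromBelow φ u x →
    ∃ r : ℝ → ℝ, r =o[𝓝[>] (0 : ℝ)] (fun ε : ℝ => ε ^ 2) ∧
      ∀ᶠ ε in 𝓝[>] (0 : ℝ), pMean p ε φ x + r ε ≤ φ x) ∧
  (∀ φ : EuclideanSpace ℝ (Fin N) → ℝ, TouchesFromAbove φ u x →
    ∃ r : ℝ → ℝ, r =o[𝓝[>] (0 : ℝ)] (fun ε : ℝ => ε ^ 2) ∧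
      ∀ᶠ ε in 𝓝[>] (0 : ℝ), φ x ≤ pMean p ε φ x + r ε)

/-!
Write `g a = |a|^(p-2) a`, and let `φ` be of class `C²` near `x` with gradient `ξ ≠ 0` and Hessian `A`.
The equivalence follows from `μ_p(ε, φ)(x) = φ(x) + β Δ_p^n φ(x) ε² + o(ε²)` with some `β > 0`
(`pMean_sub_le` and `le_pMean_sub` give the two inequalities), since then the sign of the normalized
`p`-Laplacian decides on which side of `φ(x)` the mean lies up to `o(ε²)`
(`nonpos_iff_exists_isLittleO`). The lower bound is the upper bound for `-φ`.

For `p < ∞` the function `p g` is a subgradient of `|·|^p`, hence a constant `l` with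
`∫ g(φ - l) < 0` lies above the mean (`IsPMean.le_of_integral_signedPow_neg`). After Taylor expansion
and rescaling, what matters is the derivative at `t = 0` of `∫ g(⟨ξ, z⟩ + t (½⟨A z, z⟩ - c))` over the
unit ball (`tendsto_setIntegral_signedPow`). For `p > 1` it is an integral against the weight
`|⟨ξ, z⟩|^(p-2)`, which is integrable although singular for `p < 2`; for `p = 1` it is an integral over
the section of the ball orthogonal to `ξ`. Reflections diagonalize the second moments of these
weights, and the moment along `ξ` is `p - 1` times that in an orthogonal direction
(`setIntegral_moment_relation` for `p > 1`; both sides vanish for `p = 1`), so that the integral of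
`⟨A z, z⟩` is a positive multiple of `tr A + (p - 2) ⟨A ξ, ξ⟩ / |ξ|²`, the normalized `p`-Laplacian.

For `p = ∞` the mean is the midrange (`IsPMean.eq_midrange`), and the extrema over the ball are
attained up to `o(ε²)` at `x ± ε ξ / |ξ|`.

Existence of the minimizer is compactness after truncation to the range of `v`. Uniqueness for
`p < ∞` compares with the midpoint of two minimizers; for `p = 1` it needs that the range of a
continuous function on a ball is an interval.
-/

/-! ### Signed powers -/

/-- The signed power `|a|^(p-2) a`, which is `1/p` times the derivative of `|a|^p` for `p > 1` and
the sign of `a` for `p = 1`. Its value at `0` is `0` for every `p`, thanks to the factor `a`. -/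
noncomputable def signedPow (p a : ℝ) : ℝ := |a| ^ (p - 2) * a

namespace signedPow

variable {p a b : ℝ}

lemma neg (p a : ℝ) : signedPow p (-a) = -signedPow p a := by simp [signedPow]

lemma zero (p : ℝ) : signedPow p 0 = 0 := by simp [signedPow]

lemma of_pos (p : ℝ) (ha : 0 < a) : signedPow p a = a ^ (p - 1) := by
  rw [signedPow, abs_of_pos ha, ← Real.rpow_add_one ha.ne']
  ring_nf

lemma mul_left (p : ℝ) {c : ℝ} (hc : 0 < c) (a : ℝ) :
    signedPow p (c * a) = c ^ (p - 1) * signedPow p a := by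
  rw [← of_pos p hc]
  simp only [signedPow, abs_mul, Real.mul_rpow (abs_nonneg c) (abs_nonneg a)]
  ring

lemma nonneg (ha : 0 ≤ a) : 0 ≤ signedPow p a := mul_nonneg (by positivity) ha

lemma mono_of_nonneg (hp : 1 ≤ p) (ha : 0 ≤ a) (hab : a ≤ b) : signedPow p a ≤ signedPow p b := by
  rcases ha.eq_or_lt with rfl | ha
  · rw [zero]; exact nonneg hab
  · rw [of_pos p ha, of_pos p (ha.trans_le hab)]
    exact Real.rpow_le_rpow ha.le hab (by linarith)

lemma monotone (hp : 1 ≤ p) : Monotone (signedPow p) := by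
  intro a b hab
  rcases le_total 0 a with ha | ha
  · exact mono_of_nonneg hp ha hab
  rcases le_total 0 b with hb | hb
  · have h1 := nonneg (p := p) hb
    have h2 := nonneg (p := p) (neg_nonneg.2 ha)
    rw [neg] at h2
    linarith
  · have := mono_of_nonneg hp (neg_nonneg.2 hb) (neg_le_neg hab)
    rw [neg, neg] at this
    linarith

@[fun_prop]
lemma measurable (p : ℝ) : Measurable (signedPow p) := by
  unfold signedPow; fun_prop

lemma abs_le_of_abs_le (hp : 1 ≤ p) {R : ℝ} (ha : |a| ≤ R) : |signedPow p a| ≤ signedPow p R := by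
  have h := abs_le.1 ha
  rw [abs_le, ← neg]
  exact ⟨monotone hp h.1, monotone hp h.2⟩

/-- `p` times the signed power is a subgradient of `|a|^p`, also for `p = 1`. -/
lemma abs_rpow_ge (hp : 1 ≤ p) (a b : ℝ) :
    |a| ^ p + p * signedPow p a * (b - a) ≤ |b| ^ p := by
  have key : ∀ a b : ℝ, 0 < a → |a| ^ p + p * signedPow p a * (b - a) ≤ |b| ^ p := by
    intro a b ha
    have hB := one_add_mul_self_le_rpow_one_add (s := |b| / a - 1) (p := p)
      (by have : 0 ≤ |b| / a := by positivity
          linarith) hp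
    rw [add_sub_cancel, Real.div_rpow (abs_nonneg b) ha.le, le_div_iff₀ (by positivity)] at hB
    have h1 : a ^ p = a ^ (p - 1) * a := by
      rw [← Real.rpow_add_one ha.ne']; ring_nf
    rw [of_pos p ha, abs_of_pos ha]
    have h2 : (1 + p * (|b| / a - 1)) * a ^ p = a ^ p + p * a ^ (p - 1) * (|b| - a) := by
      rw [h1]; field_simp
    have h3 : p * a ^ (p - 1) * (b - a) ≤ p * a ^ (p - 1) * (|b| - a) := by
      have := le_abs_self b
      gcongr
    linarith
  rcases lt_trichotomy a 0 with ha | rfl | ha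
  · have := key (-a) (-b) (by linarith)
    rw [abs_neg, abs_neg, neg] at this
    linarith
  · have : 0 ≤ |b| ^ p := by positivity
    simpa [zero, Real.zero_rpow (by linarith : p ≠ 0)] using this
  · exact key a b ha

lemma hasDerivAt (p : ℝ) (ha : a ≠ 0) :
    HasDerivAt (signedPow p) ((p - 1) * |a| ^ (p - 2)) a := by
  have key : ∀ a : ℝ, 0 < a → HasDerivAt (signedPow p) ((p - 1) * |a| ^ (p - 2)) a := by
    intro a ha
    have h := Real.hasDerivAt_rpow_const (x := a) (p := p - 1) (Or.inl ha.ne')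
    rw [abs_of_pos ha, show p - 2 = p - 1 - 1 by ring]
    refine h.congr_of_eventuallyEq ?_
    filter_upwards [lt_mem_nhds ha] with x hx using of_pos p hx
  rcases ha.lt_or_gt with ha | ha
  · have h := ((key (-a) (by linarith)).scomp a (hasDerivAt_neg a)).neg
    rw [abs_neg] at h
    have h1 : signedPow p = -signedPow p ∘ Neg.neg := by
      ext x; simp [neg]
    rw [h1]
    exact h.congr_deriv (by simp)
  · exact key a ha

/-- The difference quotients of a signed power with exponent `p ≤ 2` are controlled by its
derivative at the base point, even though that derivative is singular at `0`. -/
lemma abs_sub_le_of_le_two (hp : 1 ≤ p) (hp2 : p ≤ 2) (ha : a ≠ 0) (b : ℝ) :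
    |signedPow p b - signedPow p a| ≤ 2 * |b - a| * |a| ^ (p - 2) := by
  -- By homogeneity only the base point `1` matters.
  have one : ∀ c : ℝ, |signedPow p c - 1| ≤ 2 * |c - 1| := by
    intro c
    rcases lt_trichotomy c 0 with hc | rfl | hc
    · have h : signedPow p c = -(-c) ^ (p - 1) := by
        rw [← of_pos p (neg_pos.2 hc), neg, neg_neg]
      have h0 : 0 ≤ (-c) ^ (p - 1) := by have := neg_pos.2 hc; positivity
      have h1 : (-c) ^ (p - 1) ≤ 1 + -c := by
        rcases le_total (-c) 1 with h | h
        · have := Real.rpow_le_one (neg_pos.2 hc).le h (by linarith : 0 ≤ p - 1)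
          linarith
        · have := Real.rpow_le_rpow_of_exponent_le h (by linarith : p - 1 ≤ 1)
          rw [Real.rpow_one] at this
          linarith
      rw [h, abs_of_nonpos (by linarith), abs_of_nonpos (by linarith)]
      linarith
    · norm_num [zero]
    · rw [of_pos p hc]
      rcases le_total c 1 with h | h
      · have h1 := Real.rpow_le_one hc.le h (by linarith : 0 ≤ p - 1)
        have h2 := Real.rpow_le_rpow_of_exponent_ge hc h (by linarith : p - 1 ≤ 1)
        rw [Real.rpow_one] at h2
        rw [abs_of_nonpos (by linarith), abs_of_nonpos (by linarith)]
        linarith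
      · have h1 := Real.one_le_rpow h (by linarith : 0 ≤ p - 1)
        have h2 := Real.rpow_le_rpow_of_exponent_le h (by linarith : p - 1 ≤ 1)
        rw [Real.rpow_one] at h2
        rw [abs_of_nonneg (by linarith), abs_of_nonneg (by linarith)]
        linarith
  have key : ∀ a b : ℝ, 0 < a →
      |signedPow p b - signedPow p a| ≤ 2 * |b - a| * |a| ^ (p - 2) := by
    intro a b ha
    have h1 : signedPow p b = a ^ (p - 1) * signedPow p (b / a) := by
      rw [← mul_left p ha, mul_div_cancel₀ _ ha.ne']
    have h2 : a ^ (p - 1) = a ^ (p - 2) * a := by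
      rw [← Real.rpow_add_one ha.ne']; ring_nf
    rw [h1, of_pos p ha, ← mul_sub_one, abs_mul, abs_of_pos (by positivity : 0 < a ^ (p - 1)),
      abs_of_pos ha, h2]
    calc a ^ (p - 2) * a * |signedPow p (b / a) - 1|
        ≤ a ^ (p - 2) * a * (2 * |b / a - 1|) := by gcongr; exact one _
      _ = 2 * (a * |b / a - 1|) * a ^ (p - 2) := by ring
      _ = 2 * |b - a| * a ^ (p - 2) := by
        rw [← abs_of_pos ha, ← abs_mul, abs_of_pos ha, mul_sub_one, mul_div_cancel₀ _ ha.ne']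
  rcases ha.lt_or_gt with ha | ha
  · have := key (-a) (-b) (by linarith)
    rwa [neg, neg, abs_neg, neg_sub_neg, neg_sub_neg, abs_sub_comm, abs_sub_comm a b] at this
  · exact key a b ha

lemma abs_sub_le_of_two_le (hp : 2 ≤ p) {R : ℝ} (ha : |a| ≤ R) (hb : |b| ≤ R) :
    |signedPow p b - signedPow p a| ≤ (p - 1) * R ^ (p - 2) * |b - a| := by
  have hR : 0 ≤ R := (abs_nonneg a).trans ha
  have key : ∀ a b : ℝ, b ≤ R → 0 ≤ a → a ≤ b →
      signedPow p b - signedPow p a ≤ (p - 1) * R ^ (p - 2) * (b - a) := by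
    intro a b hb ha hab
    rcases (ha.trans hab).eq_or_lt with rfl | hb0
    · obtain rfl : a = 0 := le_antisymm hab ha
      simp
    have h := abs_rpow_ge (p := p - 1) (by linarith) b a
    rw [of_pos _ hb0, abs_of_pos hb0, abs_of_nonneg ha, show p - 1 - 1 = p - 2 by ring] at h
    have h1 : b ^ (p - 2) ≤ R ^ (p - 2) := Real.rpow_le_rpow hb0.le hb (by linarith)
    have h2 : signedPow p a = a ^ (p - 1) := by
      rcases ha.eq_or_lt with rfl | ha
      · rw [zero, Real.zero_rpow (by linarith)]
      · exact of_pos p ha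
    rw [of_pos p hb0, h2]
    have h3 : (p - 1) * b ^ (p - 2) * (b - a) ≤ (p - 1) * R ^ (p - 2) * (b - a) := by
      have : 0 ≤ b - a := by linarith
      have : 0 ≤ p - 1 := by linarith
      gcongr
    linarith
  have main : ∀ a b : ℝ, |a| ≤ R → |b| ≤ R → a ≤ b →
      signedPow p b - signedPow p a ≤ (p - 1) * R ^ (p - 2) * (b - a) := by
    intro a b ha hb hab
    rw [abs_le] at ha hb
    rcases le_total 0 a with h | h
    · exact key a b hb.2 h hab
    rcases le_total 0 b with h' | h'
    · have h1 := key 0 b hb.2 le_rfl h'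
      have h2 := key 0 (-a) (by linarith) le_rfl (by linarith)
      rw [zero] at h1 h2
      rw [neg] at h2
      linarith
    · have h1 := key (-b) (-a) (by linarith) (by linarith) (by linarith)
      rw [neg, neg] at h1
      linarith
  rcases le_total a b with hab | hab
  · rw [abs_of_nonneg (sub_nonneg.2 (monotone (by linarith) hab)), abs_of_nonneg (by linarith)]
    exact main a b ha hb hab
  · rw [abs_of_nonpos (sub_nonpos.2 (monotone (by linarith) hab)), abs_of_nonpos (by linarith),
      neg_sub, neg_sub]
    exact main b a hb ha hab

end signedPow

/-! ### Existence, uniqueness and optimality conditions for `p`-means -/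

section PMean

variable {N : ℕ} {p : ℝ≥0∞} {ε : ℝ} {v : EuclideanSpace ℝ (Fin N) → ℝ} {x : EuclideanSpace ℝ (Fin N)}

lemma exists_bound_sub (hv : ContinuousOn v (Metric.closedBall x ε)) (l : ℝ) :
    ∃ C, ∀ y ∈ Metric.closedBall x ε, |v y - l| ≤ C :=
  (isCompact_closedBall x ε).exists_bound_of_continuousOn (hv.sub continuousOn_const)

lemma memLp_sub (hv : ContinuousOn v (Metric.closedBall x ε)) (l : ℝ) :
    MemLp (fun y => v y - l) p (volume.restrict (Metric.closedBall x ε)) := by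
  obtain ⟨C, hC⟩ := exists_bound_sub hv l
  have : IsFiniteMeasure (volume.restrict (Metric.closedBall x ε)) :=
    isFiniteMeasure_restrict.2 (isCompact_closedBall x ε).measure_lt_top.ne
  exact MemLp.of_bound
    ((hv.sub continuousOn_const).aestronglyMeasurable Metric.isClosed_closedBall.measurableSet) C
    ((ae_restrict_iff' Metric.isClosed_closedBall.measurableSet).2 (ae_of_all _ hC))

/-- A continuous function on a closed ball which is bounded almost everywhere is bounded by the
same constant everywhere. -/
lemma forall_mem_closedBall_le_of_ae (hε : 0 < ε) (hv : ContinuousOn v (Metric.closedBall x ε))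
    {c : ℝ} (h : ∀ᵐ y ∂volume.restrict (Metric.closedBall x ε), v y ≤ c) :
    ∀ y ∈ Metric.closedBall x ε, v y ≤ c := by
  have h1 : (fun y => max (v y) c) =ᵐ[volume.restrict (Metric.closedBall x ε)] fun _ => c := by
    filter_upwards [h] with y hy using max_eq_right hy
  have h2 := Measure.eqOn_of_ae_eq h1 (hv.sup continuousOn_const) continuousOn_const
    (by rw [interior_closedBall _ hε.ne', closure_ball _ hε.ne'])
  intro y hy
  exact max_eq_right_iff.1 (h2 hy)

lemma exists_isPMean (hp : 1 ≤ p) (hε : 0 < ε) (hv : ContinuousOn v (Metric.closedBall x ε)) :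
    ∃ m, IsPMean p ε v x m := by
  set μ := volume.restrict (Metric.closedBall x ε)
  have : Fact (1 ≤ p) := ⟨hp⟩
  have hne : (Metric.closedBall x ε).Nonempty := ⟨x, Metric.mem_closedBall_self hε.le⟩
  obtain ⟨y₀, hy₀, hmin⟩ := (isCompact_closedBall x ε).exists_isMinOn hne hv
  obtain ⟨y₁, hy₁, hmax⟩ := (isCompact_closedBall x ε).exists_isMaxOn hne hv
  have h1 : MemLp (fun _ : EuclideanSpace ℝ (Fin N) => (1 : ℝ)) p μ := by
    have : IsFiniteMeasure μ :=
      isFiniteMeasure_restrict.2 (isCompact_closedBall x ε).measure_lt_top.ne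
    exact memLp_const 1
  have hv0 : MemLp v p μ := by simpa using memLp_sub (p := p) hv 0
  have key : ∀ l : ℝ, eLpNorm (fun y => v y - l) p μ = ‖hv0.toLp - l • h1.toLp‖ₑ := by
    intro l
    rw [← MemLp.toLp_const_smul, ← MemLp.toLp_sub, Lp.enorm_toLp]
    congr 1
    ext y
    simp
  have hcont : Continuous fun l : ℝ => ‖hv0.toLp - l • h1.toLp‖ₑ := by fun_prop
  obtain ⟨m, -, hm⟩ := (isCompact_Icc (a := v y₀) (b := v y₁)).exists_isMinOn
    ⟨v y₀, le_rfl, hmin hy₁⟩ hcont.continuousOn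
  refine ⟨m, fun l => ?_⟩
  -- Projecting `l` to the range of `v` does not increase the distance to `v`.
  have hle : v y₀ ≤ v y₁ := hmin hy₁
  have hproj := hm (Set.projIcc (v y₀) (v y₁) hle l).2
  simp only [Set.mem_ofPred_eq, ← key] at hproj
  refine hproj.trans (eLpNorm_mono_ae ?_)
  refine (ae_restrict_iff' Metric.isClosed_closedBall.measurableSet).2 (ae_of_all _ fun y hy => ?_)
  have ha : v y₀ ≤ v y := hmin hy
  have hb : v y ≤ v y₁ := hmax hy
  rw [Set.coe_projIcc, Real.norm_eq_abs, Real.norm_eq_abs]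
  rcases le_total l (v y₁) with h | h
  · rcases le_total (v y₀) l with h' | h'
    · simp [h, h']
    · rw [min_eq_right h, max_eq_left h', abs_of_nonneg (by linarith), abs_of_nonneg (by linarith)]
      linarith
  · rw [min_eq_left h, max_eq_right hle, abs_of_nonpos (by linarith), abs_of_nonpos (by linarith)]
    linarith

lemma integrableOn_abs_sub_rpow {q : ℝ} (hq : 0 ≤ q) (hv : ContinuousOn v (Metric.closedBall x ε))
    (l : ℝ) : IntegrableOn (fun y => |v y - l| ^ q) (Metric.closedBall x ε) :=
  ((hv.sub continuousOn_const).abs.rpow_const fun _ _ => Or.inr hq).integrableOn_compact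
    (isCompact_closedBall x ε)

lemma isPMean_iff_integral (hp : 1 ≤ p) (hp' : p ≠ ∞) (hv : ContinuousOn v (Metric.closedBall x ε))
    {m : ℝ} : IsPMean p ε v x m ↔ ∀ l : ℝ,
      ∫ y in Metric.closedBall x ε, |v y - m| ^ p.toReal
        ≤ ∫ y in Metric.closedBall x ε, |v y - l| ^ p.toReal := by
  have h0 : p ≠ 0 := (zero_lt_one.trans_le hp).ne'
  have hpos : 0 < p.toReal := ENNReal.toReal_pos h0 hp'
  have hnn : ∀ l, 0 ≤ ∫ y in Metric.closedBall x ε, |v y - l| ^ p.toReal :=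
    fun l => integral_nonneg fun y => by positivity
  refine forall_congr' fun l => ?_
  rw [(memLp_sub hv m).eLpNorm_eq_integral_rpow_norm h0 hp',
    (memLp_sub hv l).eLpNorm_eq_integral_rpow_norm h0 hp']
  simp only [Real.norm_eq_abs]
  rw [ENNReal.ofReal_le_ofReal_iff (Real.rpow_nonneg (hnn l) _),
    Real.rpow_le_rpow_iff (hnn m) (hnn l) (inv_pos.2 hpos)]

/-- Two functions continuous on a closed ball, one below the other and strictly so somewhere, have
different integrals. -/
lemma setIntegral_closedBall_lt {f g : EuclideanSpace ℝ (Fin N) → ℝ} (hε : 0 < ε)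
    (hf : ContinuousOn f (Metric.closedBall x ε)) (hg : ContinuousOn g (Metric.closedBall x ε))
    (hle : ∀ y ∈ Metric.closedBall x ε, f y ≤ g y) (hlt : ∃ y ∈ Metric.closedBall x ε, f y < g y) :
    ∫ y in Metric.closedBall x ε, f y < ∫ y in Metric.closedBall x ε, g y := by
  have hfi := hf.integrableOn_compact (μ := volume) (isCompact_closedBall x ε)
  have hgi := hg.integrableOn_compact (μ := volume) (isCompact_closedBall x ε)
  refine lt_of_le_of_ne
    (setIntegral_mono_on hfi hgi Metric.isClosed_closedBall.measurableSet hle) fun heq => ?_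
  obtain ⟨y, hy, hlt⟩ := hlt
  have h0 : ∫ y in Metric.closedBall x ε, (g - f) y = 0 := by
    simp only [Pi.sub_apply]
    rw [integral_sub hgi hfi, heq, sub_self]
  rw [setIntegral_eq_zero_iff_of_nonneg_ae ?_ (hgi.sub hfi)] at h0
  · have := forall_mem_closedBall_le_of_ae (c := 0) hε (hg.sub hf)
      (by filter_upwards [h0] with z hz using hz.le) y hy
    simp only [Pi.sub_apply] at this
    linarith
  · exact (ae_restrict_iff' Metric.isClosed_closedBall.measurableSet).2
      (ae_of_all _ fun z hz => sub_nonneg.2 (hle z hz))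

/-- A minimizer below another one is impossible for `p < ∞`. The argument covers `p = 1`, where
strict convexity fails: there connectedness of the ball makes the median unique. -/
lemma IsPMean.unique_of_lt (hp : 1 ≤ p) (hp' : p ≠ ∞) (hε : 0 < ε)
    (hv : ContinuousOn v (Metric.closedBall x ε)) {a b : ℝ} (ha : IsPMean p ε v x a)
    (hb : IsPMean p ε v x b) (hab : a < b) : False := by
  have hq : 1 ≤ p.toReal := by
    rw [← ENNReal.toReal_one]; exact ENNReal.toReal_mono hp' hp
  have hq0 : 0 < p.toReal := by linarith
  rw [isPMean_iff_integral hp hp' hv] at ha hb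
  set q := p.toReal
  have hc : ∀ l, ContinuousOn (fun y => |v y - l| ^ q) (Metric.closedBall x ε) := fun l =>
    (hv.sub continuousOn_const).abs.rpow_const fun _ _ => Or.inr hq0.le
  by_cases hex : ∃ y ∈ Metric.closedBall x ε, a < v y ∧ v y < b
  · -- The midpoint of `a` and `b` is a better competitor.
    have hcv : ∀ s t : ℝ, 0 ≤ s → 0 ≤ t → ((s + t) / 2) ^ q ≤ (s ^ q + t ^ q) / 2 := by
      intro s t hs ht
      have h := (convexOn_rpow hq).2 hs ht (by norm_num : (0 : ℝ) ≤ 1 / 2)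
        (by norm_num : (0 : ℝ) ≤ 1 / 2) (by norm_num)
      simp only [smul_eq_mul] at h
      calc ((s + t) / 2) ^ q = (1 / 2 * s + 1 / 2 * t) ^ q := by congr 1; ring
        _ ≤ 1 / 2 * s ^ q + 1 / 2 * t ^ q := h
        _ = (s ^ q + t ^ q) / 2 := by ring
    have hmid : ∀ y, |v y - (a + b) / 2| ≤ (|v y - a| + |v y - b|) / 2 := by
      intro y
      have h := abs_add_le (v y - a) (v y - b)
      have h2 : v y - (a + b) / 2 = (v y - a + (v y - b)) / 2 := by ring
      rw [h2, abs_div, abs_two]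
      linarith
    have hlt := setIntegral_closedBall_lt (f := fun y => |v y - (a + b) / 2| ^ q)
      (g := fun y => (|v y - a| ^ q + |v y - b| ^ q) / 2) hε (hc _)
      (((hc a).add (hc b)).div_const 2)
      (fun y _ => (Real.rpow_le_rpow (abs_nonneg _) (hmid y) hq0.le).trans
        (hcv _ _ (abs_nonneg _) (abs_nonneg _))) (by
        obtain ⟨y, hy, h1, h2⟩ := hex
        refine ⟨y, hy, lt_of_lt_of_le (Real.rpow_lt_rpow (abs_nonneg _) ?_ hq0)
          (hcv _ _ (abs_nonneg _) (abs_nonneg _))⟩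
        rw [abs_of_pos (sub_pos.2 h1), abs_of_neg (sub_neg.2 h2), abs_lt]
        constructor <;> linarith)
    rw [integral_div, integral_add (integrableOn_abs_sub_rpow hq0.le hv a)
      (integrableOn_abs_sub_rpow hq0.le hv b)] at hlt
    have h1 := ha ((a + b) / 2)
    have h2 := hb ((a + b) / 2)
    linarith
  · -- The range of `v` is an interval that avoids `(a, b)`, hence lies on one side of it.
    push Not at hex
    have hx : x ∈ Metric.closedBall x ε := Metric.mem_closedBall_self hε.le
    have hconn : (v '' Metric.closedBall x ε).OrdConnected :=
      (((convex_closedBall x ε).isPreconnected).image v hv).ordConnected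
    have hside : (∀ y ∈ Metric.closedBall x ε, v y ≤ a) ∨
        (∀ y ∈ Metric.closedBall x ε, b ≤ v y) := by
      by_contra! h
      obtain ⟨⟨y, hy, hya⟩, z, hz, hzb⟩ := h
      have hyb : b ≤ v y := hex y hy hya
      have hza : v z ≤ a := by
        by_contra! hc
        exact absurd hzb (not_lt.2 (hex z hz hc))
      obtain ⟨w, hw, hwe⟩ := hconn.out ⟨z, hz, rfl⟩ ⟨y, hy, rfl⟩
        (show (a + b) / 2 ∈ Set.Icc (v z) (v y) from ⟨by linarith, by linarith⟩)
      have := hex w hw (by rw [hwe]; linarith)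
      rw [hwe] at this
      linarith
    rcases hside with h | h
    · refine absurd (hb a) (not_le.2 (setIntegral_closedBall_lt hε (hc a) (hc b) ?_ ⟨x, hx, ?_⟩))
      · intro y hy
        have := h y hy
        refine Real.rpow_le_rpow (abs_nonneg _) ?_ hq0.le
        rw [abs_of_nonpos (by linarith), abs_of_nonpos (by linarith)]
        linarith
      · have := h x hx
        refine Real.rpow_lt_rpow (abs_nonneg _) ?_ hq0
        rw [abs_of_nonpos (by linarith), abs_of_nonpos (by linarith)]
        linarith
    · refine absurd (ha b) (not_le.2 (setIntegral_closedBall_lt hε (hc b) (hc a) ?_ ⟨x, hx, ?_⟩))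
      · intro y hy
        have := h y hy
        refine Real.rpow_le_rpow (abs_nonneg _) ?_ hq0.le
        rw [abs_of_nonneg (by linarith), abs_of_nonneg (by linarith)]
        linarith
      · have := h x hx
        refine Real.rpow_lt_rpow (abs_nonneg _) ?_ hq0
        rw [abs_of_nonneg (by linarith), abs_of_nonneg (by linarith)]
        linarith

lemma eLpNorm_top_closedBall_le_iff (hε : 0 < ε) (hv : ContinuousOn v (Metric.closedBall x ε))
    (l : ℝ) {C : ℝ} (hC : 0 ≤ C) :
    eLpNorm (fun y => v y - l) ∞ (volume.restrict (Metric.closedBall x ε)) ≤ ENNReal.ofReal C ↔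
      ∀ y ∈ Metric.closedBall x ε, |v y - l| ≤ C := by
  have key : eLpNorm (fun y => v y - l) ∞ (volume.restrict (Metric.closedBall x ε))
      ≤ ENNReal.ofReal C ↔ ∀ᵐ y ∂volume.restrict (Metric.closedBall x ε), |v y - l| ≤ C := by
    rw [eLpNorm_exponent_top]
    constructor
    · intro h
      filter_upwards [ae_le_eLpNormEssSup (f := fun y => v y - l)
        (μ := volume.restrict (Metric.closedBall x ε))] with y hy
      have := hy.trans h
      rwa [← ofReal_norm, ENNReal.ofReal_le_ofReal_iff hC] at this
    · intro h
      exact eLpNormEssSup_le_of_ae_bound h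
  rw [key]
  exact ⟨forall_mem_closedBall_le_of_ae hε (hv.sub continuousOn_const).abs,
    fun h => (ae_restrict_iff' Metric.isClosed_closedBall.measurableSet).2 (ae_of_all _ h)⟩

/-- The `∞`-mean is the midrange. -/
lemma IsPMean.eq_midrange (hε : 0 < ε) (hv : ContinuousOn v (Metric.closedBall x ε)) {m : ℝ}
    (hm : IsPMean ∞ ε v x m) {y₀ y₁ : EuclideanSpace ℝ (Fin N)} (hy₀ : y₀ ∈ Metric.closedBall x ε)
    (hy₁ : y₁ ∈ Metric.closedBall x ε) (hmin : ∀ y ∈ Metric.closedBall x ε, v y₀ ≤ v y)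
    (hmax : ∀ y ∈ Metric.closedBall x ε, v y ≤ v y₁) : m = (v y₀ + v y₁) / 2 := by
  have hle : v y₀ ≤ v y₁ := hmin y₁ hy₁
  have h1 := (eLpNorm_top_closedBall_le_iff (C := (v y₁ - v y₀) / 2) hε hv ((v y₀ + v y₁) / 2)
    (by linarith)).2 (fun y hy => by
      have h1 := hmin y hy
      have h2 := hmax y hy
      rw [abs_le]
      constructor <;> linarith)
  have h2 := (eLpNorm_top_closedBall_le_iff hε hv m (by linarith)).1 ((hm _).trans h1)
  have h3 := abs_le.1 (h2 y₀ hy₀)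
  have h4 := abs_le.1 (h2 y₁ hy₁)
  linarith

lemma exists_isMinMax_closedBall (hε : 0 < ε) (hv : ContinuousOn v (Metric.closedBall x ε)) :
    ∃ y₀ ∈ Metric.closedBall x ε, ∃ y₁ ∈ Metric.closedBall x ε,
      (∀ y ∈ Metric.closedBall x ε, v y₀ ≤ v y) ∧ ∀ y ∈ Metric.closedBall x ε, v y ≤ v y₁ := by
  have hne : (Metric.closedBall x ε).Nonempty := ⟨x, Metric.mem_closedBall_self hε.le⟩
  obtain ⟨y₀, hy₀, hmin⟩ := (isCompact_closedBall x ε).exists_isMinOn hne hv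
  obtain ⟨y₁, hy₁, hmax⟩ := (isCompact_closedBall x ε).exists_isMaxOn hne hv
  exact ⟨y₀, hy₀, y₁, hy₁, hmin, hmax⟩

lemma existsUnique_isPMean (hp : 1 ≤ p) (hε : 0 < ε)
    (hv : ContinuousOn v (Metric.closedBall x ε)) : ∃! m : ℝ, IsPMean p ε v x m := by
  obtain ⟨m, hm⟩ := exists_isPMean hp hε hv
  refine ⟨m, hm, fun l hl => ?_⟩
  by_cases hp' : p = ∞
  · subst hp'
    obtain ⟨y₀, hy₀, y₁, hy₁, hmin, hmax⟩ := exists_isMinMax_closedBall hε hv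
    rw [hm.eq_midrange hε hv hy₀ hy₁ hmin hmax, hl.eq_midrange hε hv hy₀ hy₁ hmin hmax]
  · rcases lt_trichotomy l m with h | h | h
    · exact (hl.unique_of_lt hp hp' hε hv hm h).elim
    · exact h
    · exact (hm.unique_of_lt hp hp' hε hv hl h).elim

lemma isPMean_pMean (hp : 1 ≤ p) (hε : 0 < ε) (hv : ContinuousOn v (Metric.closedBall x ε)) :
    IsPMean p ε v x (pMean p ε v x) :=
  Classical.epsilon_spec (exists_isPMean hp hε hv)

lemma IsPMean.neg {m : ℝ} (hm : IsPMean p ε v x m) : IsPMean p ε (fun y => -v y) x (-m) := by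
  have key : ∀ l : ℝ, eLpNorm (fun y => -v y - l) p (volume.restrict (Metric.closedBall x ε))
      = eLpNorm (fun y => v y - -l) p (volume.restrict (Metric.closedBall x ε)) := by
    intro l
    rw [← eLpNorm_neg]
    congr 1
    ext y
    simp
    ring
  intro l
  rw [key, key, neg_neg]
  exact hm (-l)

lemma integrableOn_signedPow_sub {q : ℝ} (hq : 1 ≤ q) (hv : ContinuousOn v (Metric.closedBall x ε))
    (l : ℝ) : IntegrableOn (fun y => signedPow q (v y - l)) (Metric.closedBall x ε) := by
  obtain ⟨C, hC⟩ := exists_bound_sub hv l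
  have : IsFiniteMeasure (volume.restrict (Metric.closedBall x ε)) :=
    isFiniteMeasure_restrict.2 (isCompact_closedBall x ε).measure_lt_top.ne
  refine Integrable.of_bound ?_ (signedPow q C)
    ((ae_restrict_iff' Metric.isClosed_closedBall.measurableSet).2
      (ae_of_all _ fun y hy => signedPow.abs_le_of_abs_le hq (hC y hy)))
  exact ((signedPow.measurable q).comp_aemeasurable ((hv.sub continuousOn_const).aemeasurable
    Metric.isClosed_closedBall.measurableSet)).aestronglyMeasurable

/-- One-sided form of the first-order optimality condition for the `p`-mean. -/
lemma IsPMean.le_of_integral_signedPow_neg (hp : 1 ≤ p) (hp' : p ≠ ∞)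
    (hv : ContinuousOn v (Metric.closedBall x ε)) {m l : ℝ} (hm : IsPMean p ε v x m)
    (hl : ∫ y in Metric.closedBall x ε, signedPow p.toReal (v y - l) < 0) : m ≤ l := by
  have hq : 1 ≤ p.toReal := by
    rw [← ENNReal.toReal_one]; exact ENNReal.toReal_mono hp' hp
  by_contra! hlt
  have h1 := (isPMean_iff_integral hp hp' hv).1 hm l
  set q := p.toReal
  have hgi := integrableOn_signedPow_sub hq hv l
  have h2 : ∫ y in Metric.closedBall x ε, (|v y - l| ^ q + signedPow q (v y - l) * (q * (l - m)))
      ≤ ∫ y in Metric.closedBall x ε, |v y - m| ^ q := by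
    refine integral_mono ((integrableOn_abs_sub_rpow (by linarith) hv l).add (hgi.mul_const _))
      (integrableOn_abs_sub_rpow (by linarith) hv m) fun y => ?_
    have := signedPow.abs_rpow_ge hq (v y - l) (v y - m)
    calc _ = |v y - l| ^ q + q * signedPow q (v y - l) * (v y - m - (v y - l)) := by ring
      _ ≤ _ := this
  rw [integral_add (integrableOn_abs_sub_rpow (by linarith) hv l) (hgi.mul_const _),
    integral_mul_const] at h2
  have h3 : 0 < (∫ y in Metric.closedBall x ε, signedPow q (v y - l)) * (q * (l - m)) :=
    mul_pos_of_neg_of_neg hl (mul_neg_of_pos_of_neg (by linarith) (by linarith))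
  linarith

end PMean

/-! ### Reflections, splitting off a direction, and quadratic forms -/

section InnerProductGeometry

variable {E : Type*} [NormedAddCommGroup E] [InnerProductSpace ℝ E]

lemma inner_reflection_self (f z : E) :
    inner ℝ f ((ℝ ∙ f)ᗮ.reflection z) = -inner ℝ f z := by
  rw [← (ℝ ∙ f)ᗮ.reflection.inner_map_map, Submodule.reflection_reflection,
    Submodule.reflection_orthogonalComplement_singleton_eq_neg, inner_neg_left]

lemma inner_reflection_of_inner_eq_zero {e f : E} (h : inner ℝ f e = 0) (z : E) :
    inner ℝ e ((ℝ ∙ f)ᗮ.reflection z) = inner ℝ e z := by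
  rw [← (ℝ ∙ f)ᗮ.reflection.inner_map_map, Submodule.reflection_reflection,
    Submodule.reflection_mem_subspace_eq_self
      (Submodule.mem_orthogonal_singleton_iff_inner_right.2 h)]

/-- The map `(s, y) ↦ s e + y` from `ℝ × e^⊥`, which identifies the product with the whole space when
`e` is a unit vector. -/
def splitDirection (e : E) (q : ℝ × (ℝ ∙ e)ᗮ) : E := q.1 • e + (q.2 : E)

lemma continuous_splitDirection (e : E) : Continuous (splitDirection e) := by
  unfold splitDirection; fun_prop

lemma inner_splitDirection {e : E} (he : ‖e‖ = 1) (q : ℝ × (ℝ ∙ e)ᗮ) :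
    inner ℝ e (splitDirection e q) = q.1 := by
  have := Submodule.mem_orthogonal_singleton_iff_inner_right.1 q.2.2
  rw [splitDirection, inner_add_right, inner_smul_right, this, real_inner_self_eq_norm_sq, he]
  simp

lemma norm_splitDirection_sq {e : E} (he : ‖e‖ = 1) (q : ℝ × (ℝ ∙ e)ᗮ) :
    ‖splitDirection e q‖ ^ 2 = q.1 ^ 2 + ‖q.2‖ ^ 2 := by
  have := Submodule.mem_orthogonal_singleton_iff_inner_right.1 q.2.2
  rw [splitDirection, norm_add_sq_real, inner_smul_left, this, norm_smul, he]
  simp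

lemma abs_fst_le_norm_splitDirection {e : E} (he : ‖e‖ = 1) (q : ℝ × (ℝ ∙ e)ᗮ) :
    |q.1| ≤ ‖splitDirection e q‖ := by
  refine abs_le_of_sq_le_sq ?_ (norm_nonneg _)
  rw [norm_splitDirection_sq he]
  have := sq_nonneg ‖q.2‖
  linarith

lemma norm_snd_le_norm_splitDirection {e : E} (he : ‖e‖ = 1) (q : ℝ × (ℝ ∙ e)ᗮ) :
    ‖q.2‖ ≤ ‖splitDirection e q‖ := by
  refine abs_le_of_sq_le_sq' ?_ (norm_nonneg _) |>.2
  rw [norm_splitDirection_sq he]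
  have := sq_nonneg q.1
  linarith

lemma abs_inner_le_one {e z : E} (he : ‖e‖ = 1) (hz : z ∈ Metric.closedBall (0 : E) 1) :
    |inner ℝ e z| ≤ 1 := by
  refine (abs_real_inner_le_norm e z).trans ?_
  rw [he, one_mul]
  exact mem_closedBall_zero_iff.1 hz

/-- Integration of a quadratic form against a weight whose second moments are diagonal in an
orthonormal basis, with eigenvalue `M` except for the basis vector `i₀`, where it is
`(p - 1) M`. -/
lemma integral_quadratic_of_moments {α : Type*} [MeasurableSpace α] {μ : Measure α} {ω : α → ℝ}
    {X : α → E} {ι : Type*} [Fintype ι] (b : OrthonormalBasis ι ℝ E) (i₀ : ι) {p M : ℝ}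
    (hint : ∀ i j, Integrable (fun a => ω a * (inner ℝ (b i) (X a) * inner ℝ (b j) (X a))) μ)
    (hcross : ∀ i j, i ≠ j → ∫ a, ω a * (inner ℝ (b i) (X a) * inner ℝ (b j) (X a)) ∂μ = 0)
    (h₀ : ∫ a, ω a * (inner ℝ (b i₀) (X a) * inner ℝ (b i₀) (X a)) ∂μ = (p - 1) * M)
    (hM : ∀ i, i ≠ i₀ → ∫ a, ω a * (inner ℝ (b i) (X a) * inner ℝ (b i) (X a)) ∂μ = M)
    (A : E →L[ℝ] E) :
    ∫ a, ω a * inner ℝ (A (X a)) (X a) ∂μ =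
      M * (LinearMap.trace ℝ E A + (p - 2) * inner ℝ (A (b i₀)) (b i₀)) := by
  classical
  have h1 : ∀ a, ω a * inner ℝ (A (X a)) (X a) = ∑ i, ∑ j, inner ℝ (A (b i)) (b j) *
      (ω a * (inner ℝ (b i) (X a) * inner ℝ (b j) (X a))) := by
    intro a
    conv_lhs => rw [← b.sum_repr' (X a)]
    simp only [map_sum, map_smul, sum_inner, inner_sum, real_inner_smul_left,
      real_inner_smul_right, Finset.mul_sum]
    rw [Finset.sum_comm]
    refine Finset.sum_congr rfl fun i _ => Finset.sum_congr rfl fun j _ => ?_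
    ring
  simp only [h1]
  rw [integral_finsetSum _ fun i _ => integrable_finsetSum _ fun j _ => (hint i j).const_mul _]
  have h2 : ∀ i, ∫ a, ∑ j, inner ℝ (A (b i)) (b j) *
      (ω a * (inner ℝ (b i) (X a) * inner ℝ (b j) (X a))) ∂μ =
      M * inner ℝ (A (b i)) (b i) +
        if i = i₀ then M * ((p - 2) * inner ℝ (A (b i₀)) (b i₀)) else 0 := by
    intro i
    rw [integral_finsetSum _ fun j _ => (hint i j).const_mul _]
    simp only [integral_const_mul]
    rw [Finset.sum_eq_single i (fun j _ hj => by rw [hcross i j hj.symm, mul_zero]) (by simp)]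
    split_ifs with h
    · rw [h, h₀]; ring
    · rw [hM i h]; ring
  simp only [h2]
  rw [Finset.sum_add_distrib, Finset.sum_ite_eq' Finset.univ i₀, if_pos (Finset.mem_univ _),
    LinearMap.trace_eq_sum_inner _ b, mul_add, Finset.mul_sum]
  congr 1
  refine Finset.sum_congr rfl fun i _ => ?_
  rw [real_inner_comm]
  rfl

lemma exists_orthonormalBasis_of_norm_eq_one [FiniteDimensional ℝ E] {e : E} (he : ‖e‖ = 1) :
    ∃ (u : Finset E) (b : OrthonormalBasis u ℝ E) (i₀ : u), b i₀ = e := by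
  have h : Orthonormal ℝ ((↑) : ({e} : Set E) → E) := by
    rw [orthonormal_iff_ite]
    rintro ⟨i, rfl⟩ ⟨j, rfl⟩
    simp [he]
  obtain ⟨u, b, hu, hb⟩ := h.exists_orthonormalBasis_extension
  exact ⟨u, b, ⟨e, hu rfl⟩, by rw [hb]⟩

end InnerProductGeometry

/-! ### Integrals of signed powers over the unit ball, `1 < p < ∞` -/

section InnerProductSpace

variable {E : Type*} [NormedAddCommGroup E] [InnerProductSpace ℝ E] [FiniteDimensional ℝ E]
  [MeasurableSpace E] [BorelSpace E]

lemma integrableOn_unitBall {k : E → ℝ} (hk : Continuous k) :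
    IntegrableOn k (Metric.closedBall 0 1) :=
  hk.continuousOn.integrableOn_compact (isCompact_closedBall _ _)

lemma setIntegral_unitBall_eq_zero_of_odd (R : E ≃ₗᵢ[ℝ] E) {k : E → ℝ}
    (hk : ∀ z, k (R z) = -k z) : ∫ z in Metric.closedBall (0 : E) 1, k z = 0 := by
  have h := R.measurePreserving.setIntegral_preimage_emb R.toHomeomorph.measurableEmbedding k
    (Metric.closedBall (0 : E) 1)
  rw [R.preimage_closedBall, map_zero] at h
  simp only [hk, integral_neg] at h
  linarith

lemma ae_inner_ne_zero {e : E} (he : e ≠ 0) : ∀ᵐ z : E, inner ℝ e z ≠ 0 := by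
  have h : (ℝ ∙ e)ᗮ ≠ ⊤ := by
    intro h
    have : e ∈ (ℝ ∙ e)ᗮ := h ▸ Submodule.mem_top
    rw [Submodule.mem_orthogonal_singleton_iff_inner_right] at this
    exact he (inner_self_eq_zero.1 this)
  have h0 := Measure.addHaar_submodule (volume : Measure E) _ h
  rw [ae_iff]
  convert h0 using 2
  ext z
  simp [Submodule.mem_orthogonal_singleton_iff_inner_right]

lemma setIntegral_unitBall_pos {k : E → ℝ} (hk : IntegrableOn k (Metric.closedBall 0 1))
    (h0 : ∀ z, 0 ≤ k z) (hne : ∀ᵐ z : E, k z ≠ 0) :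
    0 < ∫ z in Metric.closedBall (0 : E) 1, k z := by
  refine lt_of_le_of_ne (integral_nonneg h0) fun h => ?_
  rw [eq_comm, integral_eq_zero_iff_of_nonneg h0 hk] at h
  have hpos : 0 < volume (Metric.closedBall (0 : E) 1) :=
    Metric.measure_closedBall_pos _ _ one_pos
  have : NeZero (volume.restrict (Metric.closedBall (0 : E) 1)) :=
    ⟨fun h => hpos.ne' (Measure.restrict_eq_zero.1 h)⟩
  obtain ⟨z, hz1, hz2⟩ := (h.and (ae_restrict_of_ae hne)).exists
  exact hz2 hz1

lemma measurePreserving_splitDirection {e : E} (he : ‖e‖ = 1) :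
    MeasurePreserving (splitDirection e) volume volume := by
  have h1 := ((LinearIsometryEquiv.toSpanUnitSingleton (𝕜 := ℝ) e he).measurePreserving).prod
    (MeasurePreserving.id (volume : Measure (ℝ ∙ e)ᗮ))
  have h2 := ((ℝ ∙ e).orthogonalDecomposition.symm.measurePreserving).comp
    ((WithLp.volume_preserving_toLp (ℝ ∙ e) (ℝ ∙ e)ᗮ).comp h1)
  have h3 : splitDirection e = (ℝ ∙ e).orthogonalDecomposition.symm ∘ WithLp.toLp 2 ∘
      Prod.map (LinearIsometryEquiv.toSpanUnitSingleton (𝕜 := ℝ) e he) id := by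
    ext q
    simp [splitDirection, Submodule.orthogonalDecomposition_symm_apply]
  rw [h3]
  exact h2

lemma measurableEmbedding_splitDirection {e : E} (he : ‖e‖ = 1) :
    MeasurableEmbedding (splitDirection e) := by
  refine (continuous_splitDirection e).measurableEmbedding fun q r h => ?_
  have h1 : q.1 = r.1 := by rw [← inner_splitDirection he q, h, inner_splitDirection he]
  refine Prod.ext h1 ?_
  simp only [splitDirection, h1] at h
  exact Subtype.ext (add_left_cancel h)

lemma integrableOn_abs_rpow {r : ℝ} (hr : -1 < r) :
    IntegrableOn (fun s : ℝ => |s| ^ r) (Set.Icc (-1) 1) := by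
  have h1 : IntervalIntegrable (fun s : ℝ => |s| ^ r) volume 0 1 := by
    refine (intervalIntegral.intervalIntegrable_rpow' (a := 0) (b := 1) hr).congr ?_
    intro s hs
    rw [Set.uIoc_of_le zero_le_one] at hs
    simp only [abs_of_pos hs.1]
  have h2 : IntervalIntegrable (fun s : ℝ => |s| ^ r) volume (-1) 0 := by
    have := (IntervalIntegrable.iff_comp_neg (by simp)).1 h1
    simp only [abs_neg, neg_zero] at this
    exact this.symm
  have h3 := h2.trans h1
  rw [intervalIntegrable_iff_integrableOn_Ioc_of_le (by norm_num)] at h3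
  exact (integrableOn_Icc_iff_integrableOn_Ioc (by simp)).2 h3

/-- The derivative of `s ↦ |s|^(p-2) s` is integrable along a direction, for `p > 1`. -/
lemma integrableOn_abs_inner_rpow {e : E} (he : ‖e‖ = 1) {r : ℝ} (hr : -1 < r) :
    IntegrableOn (fun z : E => |inner ℝ e z| ^ r) (Metric.closedBall 0 1) := by
  rw [← integrable_indicator_iff Metric.isClosed_closedBall.measurableSet,
    ← (measurePreserving_splitDirection he).integrable_comp_emb
      (measurableEmbedding_splitDirection he)]
  have h1 := (integrable_indicator_iff measurableSet_Icc).2 (integrableOn_abs_rpow hr)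
  have h2 : Integrable ((Metric.closedBall (0 : (ℝ ∙ e)ᗮ) 1).indicator fun _ => (1 : ℝ)) :=
    (integrable_indicator_iff Metric.isClosed_closedBall.measurableSet).2
      (integrableOn_unitBall continuous_const)
  refine (h1.mul_prod h2).mono ?_ (ae_of_all _ fun q => ?_)
  · refine Measurable.aestronglyMeasurable ?_
    refine (Measurable.indicator ?_ Metric.isClosed_closedBall.measurableSet).comp
      (continuous_splitDirection e).measurable
    fun_prop
  · by_cases hq : splitDirection e q ∈ Metric.closedBall (0 : E) 1
    · have hq' := mem_closedBall_zero_iff.1 hq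
      rw [Function.comp_apply, Set.indicator_of_mem hq, inner_splitDirection he,
        Set.indicator_of_mem (show q.1 ∈ Set.Icc (-1 : ℝ) 1 from
          abs_le.1 ((abs_fst_le_norm_splitDirection he q).trans hq')),
        Set.indicator_of_mem (mem_closedBall_zero_iff.2
          ((norm_snd_le_norm_splitDirection he q).trans hq')), mul_one]
    · rw [Function.comp_apply, Set.indicator_of_notMem hq, norm_zero]
      exact norm_nonneg _

lemma integrableOn_abs_inner_rpow_mul {e : E} (he : ‖e‖ = 1) {r : ℝ} (hr : -1 < r) {k : E → ℝ}
    (hk : Continuous k) :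
    IntegrableOn (fun z : E => |inner ℝ e z| ^ r * k z) (Metric.closedBall 0 1) := by
  obtain ⟨C, hC⟩ := (isCompact_closedBall (0 : E) 1).exists_bound_of_continuousOn hk.continuousOn
  refine (integrableOn_abs_inner_rpow he hr).mul_bdd (c := C) hk.aestronglyMeasurable ?_
  exact (ae_restrict_iff' Metric.isClosed_closedBall.measurableSet).2 (ae_of_all _ hC)

lemma integrableOn_mul_signedPow {p : ℝ} (hp : 1 ≤ p) {k w : E → ℝ} (hk : Continuous k)
    (hw : Continuous w) :
    IntegrableOn (fun z => k z * signedPow p (w z)) (Metric.closedBall 0 1) := by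
  obtain ⟨C, hC⟩ := (isCompact_closedBall (0 : E) 1).exists_bound_of_continuousOn hw.continuousOn
  refine (integrableOn_unitBall hk).mul_bdd (c := signedPow p C) ?_ ?_
  · exact ((signedPow.measurable p).comp hw.measurable).aestronglyMeasurable
  · exact (ae_restrict_iff' Metric.isClosed_closedBall.measurableSet).2
      (ae_of_all _ fun z hz => signedPow.abs_le_of_abs_le hp (hC z hz))

/-- Differentiation under the integral sign. For `p < 2` the derivative of the signed power is
singular on the hyperplane orthogonal to `e`, but integrable. -/
lemma tendsto_setIntegral_signedPow_slope {p : ℝ} (hp : 1 < p) {e : E} (he : ‖e‖ = 1)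
    {k w : E → ℝ} (hk : Continuous k) (hw : Continuous w) :
    Tendsto (fun t : ℝ => t⁻¹ * ∫ z in Metric.closedBall (0 : E) 1,
        k z * (signedPow p (inner ℝ e z + t * w z) - signedPow p (inner ℝ e z))) (𝓝[>] 0)
      (𝓝 ((p - 1) * ∫ z in Metric.closedBall (0 : E) 1,
        |inner ℝ e z| ^ (p - 2) * (k z * w z))) := by
  obtain ⟨Ck, hCk⟩ := (isCompact_closedBall (0 : E) 1).exists_bound_of_continuousOn hk.continuousOn
  obtain ⟨Cw, hCw⟩ := (isCompact_closedBall (0 : E) 1).exists_bound_of_continuousOn hw.continuousOn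
  have h00 : (0 : E) ∈ Metric.closedBall (0 : E) 1 := Metric.mem_closedBall_self zero_le_one
  have hCk0 : 0 ≤ Ck := (norm_nonneg _).trans (hCk 0 h00)
  have hCw0 : 0 ≤ Cw := (norm_nonneg _).trans (hCw 0 h00)
  have hne : ∀ᵐ z : E, inner ℝ e z ≠ 0 := ae_inner_ne_zero (by rintro rfl; simp at he)
  have hbound : ∃ D : E → ℝ, IntegrableOn D (Metric.closedBall 0 1) ∧ ∀ t : ℝ, 0 < t → t ≤ 1 →
      ∀ z ∈ Metric.closedBall (0 : E) 1, inner ℝ e z ≠ 0 →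
        |signedPow p (inner ℝ e z + t * w z) - signedPow p (inner ℝ e z)| ≤ t * D z := by
    rcases le_total p 2 with hp2 | hp2
    · refine ⟨fun z => 2 * Cw * |inner ℝ e z| ^ (p - 2),
        (integrableOn_abs_inner_rpow he (by linarith)).const_mul _, fun t ht _ z hz h0 => ?_⟩
      refine (signedPow.abs_sub_le_of_le_two hp.le hp2 h0 _).trans ?_
      rw [add_sub_cancel_left, abs_mul, abs_of_pos ht]
      have := hCw z hz
      rw [Real.norm_eq_abs] at this
      calc 2 * (t * |w z|) * |inner ℝ e z| ^ (p - 2)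
          ≤ 2 * (t * Cw) * |inner ℝ e z| ^ (p - 2) := by gcongr
        _ = _ := by ring
    · refine ⟨fun _ => (p - 1) * (1 + Cw) ^ (p - 2) * Cw, integrableOn_unitBall continuous_const,
        fun t ht ht1 z hz _ => ?_⟩
      have h1 := abs_inner_le_one he hz
      have h2 := hCw z hz
      rw [Real.norm_eq_abs] at h2
      have h3 : |t * w z| ≤ Cw := by
        rw [abs_mul, abs_of_pos ht]
        nlinarith [abs_nonneg (w z)]
      refine (signedPow.abs_sub_le_of_two_le (R := 1 + Cw) hp2 (by linarith)
        ((abs_add_le _ _).trans (by linarith))).trans ?_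
      rw [add_sub_cancel_left, abs_mul, abs_of_pos ht]
      have : 0 ≤ p - 1 := by linarith
      calc (p - 1) * (1 + Cw) ^ (p - 2) * (t * |w z|)
          ≤ (p - 1) * (1 + Cw) ^ (p - 2) * (t * Cw) := by gcongr
        _ = _ := by ring
  obtain ⟨D, hD, hDt⟩ := hbound
  have hsmall : ∀ᶠ t : ℝ in 𝓝[>] 0, 0 < t ∧ t ≤ 1 := by
    filter_upwards [Ioc_mem_nhdsGT (zero_lt_one (α := ℝ))] with t ht using ht
  have hDCT := tendsto_integral_filter_of_dominated_convergence
    (μ := volume.restrict (Metric.closedBall (0 : E) 1)) (l := 𝓝[>] (0 : ℝ))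
    (F := fun t z => t⁻¹ *
      (k z * (signedPow p (inner ℝ e z + t * w z) - signedPow p (inner ℝ e z))))
    (f := fun z => (p - 1) * (|inner ℝ e z| ^ (p - 2) * (k z * w z)))
    (fun z => Ck * D z) ?_ ?_ (hD.const_mul Ck) ?_
  · simpa only [integral_const_mul] using hDCT
  · refine Eventually.of_forall fun t => Measurable.aestronglyMeasurable ?_
    have := hk.measurable
    have := hw.measurable
    fun_prop
  · filter_upwards [hsmall] with t ht
    rw [ae_restrict_iff' Metric.isClosed_closedBall.measurableSet]
    filter_upwards [hne] with z hz0 hz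
    have h1 := hDt t ht.1 ht.2 z hz hz0
    have h2 := hCk z hz
    rw [norm_mul, norm_mul, norm_inv, Real.norm_of_nonneg ht.1.le, inv_mul_le_iff₀ ht.1]
    calc _ ≤ Ck * (t * D z) := mul_le_mul h2 h1 (abs_nonneg _) hCk0
      _ = _ := by ring
  · refine ae_restrict_of_ae ?_
    filter_upwards [hne] with z hz
    have h1 : HasDerivAt (fun t : ℝ => inner ℝ e z + t * w z) (w z) 0 := by
      simpa using ((hasDerivAt_id (0 : ℝ)).mul_const (w z)).const_add (inner ℝ e z)
    have h2 : HasDerivAt (signedPow p) ((p - 1) * |inner ℝ e z| ^ (p - 2))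
        (inner ℝ e z + 0 * w z) := by
      simpa using signedPow.hasDerivAt p hz
    have h3 := ((h2.comp (0 : ℝ) h1).tendsto_slope_zero_right).const_mul (k z)
    convert h3 using 2
    · simp; ring
    · ring

lemma setIntegral_signedPow_mul_inner_eq_zero {p : ℝ} {e f : E} (hef : inner ℝ f e = 0) :
    ∫ z in Metric.closedBall (0 : E) 1, signedPow p (inner ℝ e z) * inner ℝ f z = 0 :=
  setIntegral_unitBall_eq_zero_of_odd (ℝ ∙ f)ᗮ.reflection fun z => by
    rw [inner_reflection_self, inner_reflection_of_inner_eq_zero hef]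
    ring

lemma setIntegral_signedPow_eq_zero (p : ℝ) (e : E) :
    ∫ z in Metric.closedBall (0 : E) 1, signedPow p (inner ℝ e z) = 0 :=
  setIntegral_unitBall_eq_zero_of_odd (LinearIsometryEquiv.neg ℝ) fun z => by
    simp [signedPow.neg]

/-- The relation between the weighted second moments of the ball in the direction `e` and in an
orthogonal direction. It comes from the infinitesimal rotation of the vanishing integral of
`|⟨e, z⟩|^(p-2) ⟨e, z⟩ ⟨f, z⟩` in the plane spanned by `e` and `f`. -/
lemma setIntegral_moment_relation {p : ℝ} (hp : 1 < p) {e f : E} (he : ‖e‖ = 1) (hf : ‖f‖ = 1)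
    (hef : inner ℝ e f = 0) :
    ∫ z in Metric.closedBall (0 : E) 1, |inner ℝ e z| ^ (p - 2) * (inner ℝ e z * inner ℝ e z) =
      (p - 1) * ∫ z in Metric.closedBall (0 : E) 1,
        |inner ℝ e z| ^ (p - 2) * (inner ℝ f z * inner ℝ f z) := by
  have hce : Continuous fun z : E => (inner ℝ e z : ℝ) := by fun_prop
  have hcf : Continuous fun z : E => (inner ℝ f z : ℝ) := by fun_prop
  have hfe : inner ℝ f e = 0 := by rw [real_inner_comm]; exact hef
  -- The vectors `e + t f` and `f - t e` are orthogonal, so the same integral vanishes for them.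
  have key : ∀ t : ℝ, 0 < t →
      t⁻¹ * ∫ z in Metric.closedBall (0 : E) 1, inner ℝ f z *
        (signedPow p (inner ℝ e z + t * inner ℝ f z) - signedPow p (inner ℝ e z)) =
      ∫ z in Metric.closedBall (0 : E) 1,
        inner ℝ e z * signedPow p (inner ℝ e z + t * inner ℝ f z) := by
    intro t ht
    have hcs : Continuous fun z : E => (inner ℝ e z + t * inner ℝ f z : ℝ) := by fun_prop
    have h1 : ∫ z in Metric.closedBall (0 : E) 1,
        signedPow p (inner ℝ (e + t • f) z) * inner ℝ (f - t • e) z = 0 := by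
      apply setIntegral_signedPow_mul_inner_eq_zero
      simp only [inner_sub_left, inner_add_right, inner_smul_left, inner_smul_right, hef, hfe,
        real_inner_self_eq_norm_sq, he, hf]
      simp
    have h2 := setIntegral_signedPow_mul_inner_eq_zero (p := p) hfe
    have h3 : ∀ z : E, inner ℝ f z *
        (signedPow p (inner ℝ e z + t * inner ℝ f z) - signedPow p (inner ℝ e z)) =
        t * (inner ℝ e z * signedPow p (inner ℝ e z + t * inner ℝ f z)) +
        (signedPow p (inner ℝ (e + t • f) z) * inner ℝ (f - t • e) z -
          signedPow p (inner ℝ e z) * inner ℝ f z) := by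
      intro z
      simp only [inner_add_left, inner_sub_left, real_inner_smul_left]
      ring
    have i1 := integrableOn_mul_signedPow hp.le hce hcs
    have i2 : IntegrableOn (fun z : E => signedPow p (inner ℝ (e + t • f) z) *
        inner ℝ (f - t • e) z) (Metric.closedBall 0 1) := by
      simpa only [mul_comm] using integrableOn_mul_signedPow (E := E) hp.le
        (k := fun z => inner ℝ (f - t • e) z) (w := fun z => inner ℝ (e + t • f) z)
        (by fun_prop) (by fun_prop)
    have i3 : IntegrableOn (fun z : E => signedPow p (inner ℝ e z) * inner ℝ f z)
        (Metric.closedBall 0 1) := by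
      simpa only [mul_comm] using integrableOn_mul_signedPow hp.le hcf hce
    simp only [h3]
    have i4 : IntegrableOn (fun z : E => signedPow p (inner ℝ (e + t • f) z) *
        inner ℝ (f - t • e) z - signedPow p (inner ℝ e z) * inner ℝ f z)
        (Metric.closedBall 0 1) := i2.sub i3
    rw [integral_add (i1.const_mul t) i4, integral_sub i2 i3, h1, h2, integral_const_mul]
    field_simp
    ring
  have lim1 := tendsto_setIntegral_signedPow_slope hp he hcf hcf
  have lim2 : Tendsto (fun t : ℝ => ∫ z in Metric.closedBall (0 : E) 1,
      inner ℝ e z * signedPow p (inner ℝ e z + t * inner ℝ f z)) (𝓝[>] 0)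
      (𝓝 (∫ z in Metric.closedBall (0 : E) 1, inner ℝ e z * signedPow p (inner ℝ e z))) := by
    have h0 : Tendsto (fun t : ℝ => t) (𝓝[>] 0) (𝓝 0) := tendsto_id.mono_left nhdsWithin_le_nhds
    have h := (h0.mul (tendsto_setIntegral_signedPow_slope hp he hce hcf)).add_const
      (∫ z in Metric.closedBall (0 : E) 1, inner ℝ e z * signedPow p (inner ℝ e z))
    rw [zero_mul, zero_add] at h
    refine h.congr' ?_
    filter_upwards [self_mem_nhdsWithin] with t ht
    have ht : 0 < t := ht
    rw [mul_inv_cancel_left₀ ht.ne', ← integral_add]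
    · congr 1; ext z; ring
    · simp only [mul_sub]
      exact (integrableOn_mul_signedPow hp.le hce (by fun_prop)).sub
        (integrableOn_mul_signedPow hp.le hce hce)
    · exact integrableOn_mul_signedPow hp.le hce hce
  have h := tendsto_nhds_unique (lim2.congr' ?_) lim1
  · rw [← h]
    congr 1; ext z; rw [signedPow]; ring
  · filter_upwards [self_mem_nhdsWithin] with t ht using (key t ht).symm

/-- The asymptotics behind the `p`-mean of a quadratic polynomial with nonzero gradient,
for `1 < p < ∞`. -/
lemma tendsto_setIntegral_signedPow_of_one_lt {p : ℝ} (hp : 1 < p) {e : E} (he : ‖e‖ = 1)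
    (A : E →L[ℝ] E) : ∃ β > 0, ∃ K > 0, ∀ c : ℝ,
      Tendsto (fun t : ℝ => t⁻¹ * ∫ z in Metric.closedBall (0 : E) 1,
        signedPow p (inner ℝ e z + t * (1 / 2 * inner ℝ (A z) z - c))) (𝓝[>] 0)
      (𝓝 (K * (β * (LinearMap.trace ℝ E A + (p - 2) * inner ℝ (A e) e) - c))) := by
  have hr : -1 < p - 2 := by linarith
  have hp1 : 0 < p - 1 := by linarith
  have hne : ∀ᵐ z : E, inner ℝ e z ≠ 0 := ae_inner_ne_zero (by rintro rfl; simp at he)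
  set W := ∫ z in Metric.closedBall (0 : E) 1, |inner ℝ e z| ^ (p - 2) with hW
  set M₀ := ∫ z in Metric.closedBall (0 : E) 1,
    |inner ℝ e z| ^ (p - 2) * (inner ℝ e z * inner ℝ e z) with hM₀
  have hWpos : 0 < W := by
    refine setIntegral_unitBall_pos (integrableOn_abs_inner_rpow he hr) (fun z => by positivity) ?_
    filter_upwards [hne] with z hz
    positivity
  have hMpos : 0 < M₀ := by
    refine setIntegral_unitBall_pos (integrableOn_abs_inner_rpow_mul he hr (by fun_prop))
      (fun z => mul_nonneg (by positivity) (mul_self_nonneg _)) ?_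
    filter_upwards [hne] with z hz
    have := mul_self_pos.2 hz
    positivity
  obtain ⟨u, b, i₀, hb⟩ := exists_orthonormalBasis_of_norm_eq_one he
  have hquad : ∫ z in Metric.closedBall (0 : E) 1, |inner ℝ e z| ^ (p - 2) * inner ℝ (A z) z =
      M₀ / (p - 1) * (LinearMap.trace ℝ E A + (p - 2) * inner ℝ (A e) e) := by
    rw [← hb]
    refine integral_quadratic_of_moments (X := fun z => z) b i₀ ?_ ?_ ?_ ?_ A
    · exact fun i j => integrableOn_abs_inner_rpow_mul (hb ▸ he) hr (by fun_prop)
    · -- One of the two indices differs from `i₀`; reflect in that direction.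
      have key : ∀ i j, i ≠ j → i ≠ i₀ → ∫ z in Metric.closedBall (0 : E) 1,
          |inner ℝ (b i₀) z| ^ (p - 2) * (inner ℝ (b i) z * inner ℝ (b j) z) = 0 := by
        intro i j hij hi
        refine setIntegral_unitBall_eq_zero_of_odd (ℝ ∙ b i)ᗮ.reflection fun z => ?_
        rw [inner_reflection_self, inner_reflection_of_inner_eq_zero (b.orthonormal.2 hij),
          inner_reflection_of_inner_eq_zero (b.orthonormal.2 hi)]
        ring
      intro i j hij
      by_cases hi : i = i₀
      · have := key j i hij.symm (fun h => hij (hi.trans h.symm))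
        simpa only [mul_comm] using this
      · exact key i j hij hi
    · rw [hb, ← hM₀]; field_simp
    · intro i hi
      have := setIntegral_moment_relation hp he (b.orthonormal.1 i)
        (by rw [← hb]; exact b.orthonormal.2 (Ne.symm hi))
      rw [hb, hM₀, this]
      field_simp
  refine ⟨M₀ / (p - 1) / (2 * W), by positivity, (p - 1) * W, by positivity, fun c => ?_⟩
  have hAc : Continuous fun z : E => 1 / 2 * inner ℝ (A z) z - c := by fun_prop
  have h := tendsto_setIntegral_signedPow_slope hp he (k := fun _ => 1) continuous_const hAc
  have hlim : (p - 1) * ∫ z in Metric.closedBall (0 : E) 1,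
      |inner ℝ e z| ^ (p - 2) * (1 * (1 / 2 * inner ℝ (A z) z - c)) =
      (p - 1) * W * (M₀ / (p - 1) / (2 * W) *
        (LinearMap.trace ℝ E A + (p - 2) * inner ℝ (A e) e) - c) := by
    have h1 : ∀ z : E, |inner ℝ e z| ^ (p - 2) * (1 * (1 / 2 * inner ℝ (A z) z - c)) =
        1 / 2 * (|inner ℝ e z| ^ (p - 2) * inner ℝ (A z) z) - c * |inner ℝ e z| ^ (p - 2) := by
      intro z; ring
    simp only [h1]
    rw [integral_sub ((integrableOn_abs_inner_rpow_mul he hr (by fun_prop)).const_mul _)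
      ((integrableOn_abs_inner_rpow he hr).const_mul _), integral_const_mul, integral_const_mul,
      hquad, ← hW]
    field_simp
  rw [hlim] at h
  refine h.congr fun t => ?_
  have i1 := integrableOn_mul_signedPow (E := E) hp.le (k := fun _ => 1)
    (w := fun z => inner ℝ e z + t * (1 / 2 * inner ℝ (A z) z - c)) continuous_const (by fun_prop)
  have i2 := integrableOn_mul_signedPow (E := E) hp.le (k := fun _ => 1)
    (w := fun z => inner ℝ e z) continuous_const (by fun_prop)
  simp only [one_mul] at i1 i2 ⊢
  rw [integral_sub i1 i2, setIntegral_signedPow_eq_zero, sub_zero]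

end InnerProductSpace

/-! ### Integrals of signs over the unit ball, `p = 1` -/

namespace signedPow

lemma one_of_pos {a : ℝ} (ha : 0 < a) : signedPow 1 a = 1 := by
  rw [of_pos 1 ha, sub_self, Real.rpow_zero]

lemma one_of_neg {a : ℝ} (ha : a < 0) : signedPow 1 a = -1 := by
  rw [← neg_neg a, neg, one_of_pos (neg_pos.2 ha)]

lemma abs_one_le (a : ℝ) : |signedPow 1 a| ≤ 1 := by
  rcases lt_trichotomy a 0 with h | rfl | h
  · simp [one_of_neg h]
  · simp [zero]
  · simp [one_of_pos h]

lemma one_mul_left {t : ℝ} (ht : 0 < t) (a : ℝ) : signedPow 1 (t * a) = signedPow 1 a := by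
  rw [mul_left 1 ht, sub_self, Real.rpow_zero, one_mul]

/-- For `c > 0` the integrand is `2` on `(-c, 0)` and `0` outside of `[-c, 0]`. -/
lemma integral_one_add_sub (c : ℝ) : ∫ s : ℝ, (signedPow 1 (s + c) - signedPow 1 s) = 2 * c := by
  have key : ∀ c : ℝ, 0 ≤ c → ∫ s : ℝ, (signedPow 1 (s + c) - signedPow 1 s) = 2 * c := by
    intro c hc
    have h : (fun s : ℝ => signedPow 1 (s + c) - signedPow 1 s) =ᵐ[volume]
        (Set.Ioo (-c) 0).indicator fun _ => (2 : ℝ) := by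
      filter_upwards [compl_mem_ae_iff.2 (measure_singleton (0 : ℝ)),
        compl_mem_ae_iff.2 (measure_singleton (-c))] with s hs hs'
      rcases lt_or_gt_of_ne hs with h1 | h1
      · rcases lt_or_gt_of_ne hs' with h2 | h2
        · rw [Set.indicator_of_notMem (fun h => absurd h.1 (not_lt.2 h2.le)), one_of_neg h1,
            one_of_neg (by linarith), sub_self]
        · rw [Set.indicator_of_mem (show s ∈ Set.Ioo (-c) 0 from ⟨h2, h1⟩), one_of_neg h1, one_of_pos (by linarith)]
          norm_num
      · rw [Set.indicator_of_notMem (fun h => absurd h.2 (not_lt.2 h1.le)), one_of_pos h1,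
            one_of_pos (by linarith), sub_self]
    rw [integral_congr_ae h, integral_indicator measurableSet_Ioo, setIntegral_const]
    simp [Measure.real, hc]
    ring
  rcases le_total 0 c with hc | hc
  · exact key c hc
  · rw [← integral_sub_right_eq_self _ c]
    have h := key (-c) (neg_nonneg.2 hc)
    simp only [sub_add_cancel]
    have h1 : ∀ s, signedPow 1 s - signedPow 1 (s - c) =
        -(signedPow 1 (s + -c) - signedPow 1 s) := by
      intro s; rw [← sub_eq_add_neg]; ring
    simp only [h1]
    rw [integral_neg, h]
    ring

end signedPow

section InnerProductSpace

variable {E : Type*} [NormedAddCommGroup E] [InnerProductSpace ℝ E] [FiniteDimensional ℝ E]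
  [MeasurableSpace E] [BorelSpace E]

/-- For `p = 1` the derivative of the signed power is twice the Dirac mass at `0`, so that the
derivative of the integral is carried by the section of the ball orthogonal to `e`. -/
lemma tendsto_setIntegral_signedPow_one_slope {e : E} (he : ‖e‖ = 1) {w : E → ℝ}
    (hw : Continuous w) :
    Tendsto (fun t : ℝ => t⁻¹ * ∫ z in Metric.closedBall (0 : E) 1,
        signedPow 1 (inner ℝ e z + t * w z)) (𝓝[>] 0)
      (𝓝 (∫ y in Metric.closedBall (0 : (ℝ ∙ e)ᗮ) 1, 2 * w y)) := by
  obtain ⟨W, hW⟩ := (isCompact_closedBall (0 : E) 1).exists_bound_of_continuousOn hw.continuousOn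
  have hmB : MeasurableSet (Metric.closedBall (0 : E) 1) :=
    Metric.isClosed_closedBall.measurableSet
  have hmD : MeasurableSet (Metric.closedBall (0 : (ℝ ∙ e)ᗮ) 1) :=
    Metric.isClosed_closedBall.measurableSet
  set G : ℝ → E → ℝ := fun t => (Metric.closedBall (0 : E) 1).indicator fun z =>
    signedPow 1 (inner ℝ e z + t * w z) - signedPow 1 (inner ℝ e z) with hG
  have hGm : ∀ t, Measurable (G t) := by
    intro t
    have := hw.measurable
    exact Measurable.indicator (by fun_prop) hmB
  have hsplit : Measurable (splitDirection e) := (continuous_splitDirection e).measurable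
  have hGint : ∀ t, Integrable (G t) := by
    intro t
    have i1 := integrableOn_mul_signedPow (E := E) le_rfl (k := fun _ => 1)
      (w := fun z => inner ℝ e z + t * w z) continuous_const (by fun_prop)
    have i2 := integrableOn_mul_signedPow (E := E) le_rfl (k := fun _ => 1)
      (w := fun z => inner ℝ e z) continuous_const (by fun_prop)
    simp only [one_mul] at i1 i2
    exact (integrable_indicator_iff hmB).2 (i1.sub i2)
  have hGint' : ∀ t, Integrable (fun q => G t (splitDirection e q)) := fun t =>
    ((measurePreserving_splitDirection he).integrable_comp_emb
      (measurableEmbedding_splitDirection he)).2 (hGint t)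
  -- Fubini, and the rescaling `s = t σ` in the direction of `e`.
  have hfub : ∀ t : ℝ, 0 < t → t⁻¹ * ∫ z in Metric.closedBall (0 : E) 1,
      signedPow 1 (inner ℝ e z + t * w z) =
      ∫ y : (ℝ ∙ e)ᗮ, ∫ σ : ℝ, G t (splitDirection e (t * σ, y)) := by
    intro t ht
    have h1 : ∫ z in Metric.closedBall (0 : E) 1, signedPow 1 (inner ℝ e z + t * w z) =
        ∫ z, G t z := by
      have i1 := integrableOn_mul_signedPow (E := E) le_rfl (k := fun _ => 1)
        (w := fun z => inner ℝ e z + t * w z) continuous_const (by fun_prop)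
      have i2 := integrableOn_mul_signedPow (E := E) le_rfl (k := fun _ => 1)
        (w := fun z => inner ℝ e z) continuous_const (by fun_prop)
      simp only [one_mul] at i1 i2
      rw [hG, integral_indicator hmB, integral_sub i1 i2, setIntegral_signedPow_eq_zero, sub_zero]
    rw [h1, ← (measurePreserving_splitDirection he).integral_comp
      (measurableEmbedding_splitDirection he), Measure.volume_eq_prod,
      integral_prod_symm _ (hGint' t), ← integral_const_mul]
    refine integral_congr_ae (ae_of_all _ fun y => ?_)
    have := Measure.integral_comp_mul_left (fun s => G t (splitDirection e (s, y))) t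
    simp only [abs_inv, abs_of_pos ht, smul_eq_mul] at this
    exact this.symm
  have hmem : ∀ {t σ : ℝ} {y : (ℝ ∙ e)ᗮ}, 0 < t →
      splitDirection e (t * σ, y) ∈ Metric.closedBall (0 : E) 1 →
      G t (splitDirection e (t * σ, y)) =
        signedPow 1 (σ + w (splitDirection e (t * σ, y))) - signedPow 1 σ := by
    intro t σ y ht h
    rw [hG]
    simp only
    rw [Set.indicator_of_mem h, inner_splitDirection he, ← mul_add,
      signedPow.one_mul_left ht, signedPow.one_mul_left ht]
  have hout : ∀ {t σ : ℝ} {y : (ℝ ∙ e)ᗮ}, y ∉ Metric.closedBall (0 : (ℝ ∙ e)ᗮ) 1 →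
      G t (splitDirection e (t * σ, y)) = 0 := by
    intro t σ y h
    refine Set.indicator_of_notMem (fun h' => h ?_) _
    rw [mem_closedBall_zero_iff] at h' ⊢
    exact (norm_snd_le_norm_splitDirection he _).trans h'
  have hbound : ∀ {t : ℝ} (σ : ℝ) (y : (ℝ ∙ e)ᗮ), 0 < t →
      ‖G t (splitDirection e (t * σ, y))‖ ≤ (Set.Icc (-W) W).indicator (fun _ => (2 : ℝ)) σ := by
    intro t σ y ht
    by_cases h : splitDirection e (t * σ, y) ∈ Metric.closedBall (0 : E) 1
    · rw [hmem ht h, Real.norm_eq_abs]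
      have hw1 := abs_le.1 (hW _ h)
      by_cases hσ : σ ∈ Set.Icc (-W) W
      · rw [Set.indicator_of_mem hσ]
        refine (abs_sub _ _).trans ?_
        have h1 := signedPow.abs_one_le (σ + w (splitDirection e (t * σ, y)))
        have h2 := signedPow.abs_one_le σ
        linarith
      · rw [Set.indicator_of_notMem hσ]
        rw [Set.mem_Icc, not_and_or, not_le, not_le] at hσ
        rcases hσ with hσ | hσ
        · rw [signedPow.one_of_neg (by linarith), signedPow.one_of_neg (by linarith)]
          simp
        · rw [signedPow.one_of_pos (by linarith), signedPow.one_of_pos (by linarith)]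
          simp
    · have : G t (splitDirection e (t * σ, y)) = 0 := Set.indicator_of_notMem h _
      rw [this, norm_zero]
      exact Set.indicator_nonneg (fun _ _ => zero_le_two) σ
  have hbint : Integrable ((Set.Icc (-W) W).indicator fun _ => (2 : ℝ)) :=
    (integrable_indicator_iff measurableSet_Icc).2 (integrableOn_const (by simp))
  have hpos : ∀ᶠ t : ℝ in 𝓝[>] 0, 0 < t := self_mem_nhdsWithin
  have hsphere : ∀ᵐ y : (ℝ ∙ e)ᗮ, y ∉ Metric.sphere (0 : (ℝ ∙ e)ᗮ) 1 :=
    compl_mem_ae_iff.2 (Measure.addHaar_sphere_of_ne_zero volume 0 one_ne_zero)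
  have hlim : Tendsto (fun t : ℝ => ∫ y in Metric.closedBall (0 : (ℝ ∙ e)ᗮ) 1,
      ∫ σ : ℝ, G t (splitDirection e (t * σ, y))) (𝓝[>] 0)
      (𝓝 (∫ y in Metric.closedBall (0 : (ℝ ∙ e)ᗮ) 1, 2 * w y)) := by
    refine tendsto_integral_filter_of_dominated_convergence
      (fun _ => ∫ σ, (Set.Icc (-W) W).indicator (fun _ => (2 : ℝ)) σ) ?_ ?_
      (integrableOn_unitBall continuous_const) ?_
    · refine Eventually.of_forall fun t => AEStronglyMeasurable.restrict ?_
      have hm : Measurable fun q : (ℝ ∙ e)ᗮ × ℝ => G t (splitDirection e (t * q.2, q.1)) :=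
        (hGm t).comp (hsplit.comp (by fun_prop))
      exact hm.aestronglyMeasurable.integral_prod_right'
    · filter_upwards [hpos] with t ht
      exact ae_of_all _ fun y =>
        norm_integral_le_of_norm_le hbint (ae_of_all _ fun σ => hbound σ y ht)
    · rw [ae_restrict_iff' hmD]
      filter_upwards [hsphere] with y hy hyD
      have hy1 : ‖y‖ < 1 := lt_of_le_of_ne (mem_closedBall_zero_iff.1 hyD)
        fun h => hy (mem_sphere_zero_iff_norm.2 h)
      rw [← signedPow.integral_one_add_sub]
      refine tendsto_integral_filter_of_dominated_convergence _ ?_ ?_ hbint ?_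
      · refine Eventually.of_forall fun t => Measurable.aestronglyMeasurable ?_
        exact (hGm t).comp (hsplit.comp (by fun_prop))
      · filter_upwards [hpos] with t ht
        exact ae_of_all _ fun σ => hbound σ y ht
      · filter_upwards [compl_mem_ae_iff.2 (measure_singleton (-w y))] with σ hσ
        have hσ' : σ + w y ≠ 0 := fun h => hσ (eq_neg_of_add_eq_zero_left h)
        have hz : Tendsto (fun t : ℝ => splitDirection e (t * σ, y)) (𝓝[>] 0) (𝓝 (y : E)) := by
          have hc : Continuous fun t : ℝ => splitDirection e (t * σ, y) :=
            (continuous_splitDirection e).comp (by fun_prop)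
          have h := hc.tendsto 0
          simp only [splitDirection, zero_mul, zero_smul, zero_add] at h
          exact h.mono_left nhdsWithin_le_nhds
        have hev : ∀ᶠ t : ℝ in 𝓝[>] 0,
            splitDirection e (t * σ, y) ∈ Metric.closedBall (0 : E) 1 := by
          refine hz.eventually (Metric.closedBall_mem_nhds_of_mem ?_)
          rw [mem_ball_zero_iff]
          exact hy1
        have hlim := ((signedPow.hasDerivAt 1 hσ').continuousAt.tendsto.comp
          ((hw.continuousAt.tendsto.comp hz).const_add σ)).sub_const (signedPow 1 σ)
        refine hlim.congr' ?_
        filter_upwards [hpos, hev] with t ht h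
        exact (hmem ht h).symm
  refine hlim.congr' ?_
  filter_upwards [hpos] with t ht
  rw [hfub t ht]
  refine setIntegral_eq_integral_of_forall_compl_eq_zero fun y hy => ?_
  simp only [hout hy, integral_zero]

lemma setIntegral_inner_mul_inner_eq_zero {u v : E} (h : inner ℝ u v = 0) :
    ∫ z in Metric.closedBall (0 : E) 1, inner ℝ u z * inner ℝ v z = 0 :=
  setIntegral_unitBall_eq_zero_of_odd (ℝ ∙ u)ᗮ.reflection fun z => by
    rw [inner_reflection_self, inner_reflection_of_inner_eq_zero h]
    ring

/-- The second moments of the unit ball in any two directions agree. -/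
lemma setIntegral_inner_sq_eq {u v : E} (hu : ‖u‖ = 1) (hv : ‖v‖ = 1) :
    ∫ z in Metric.closedBall (0 : E) 1, inner ℝ u z * inner ℝ u z =
      ∫ z in Metric.closedBall (0 : E) 1, inner ℝ v z * inner ℝ v z := by
  have h := setIntegral_inner_mul_inner_eq_zero (u := u + v) (v := u - v) (by
    rw [real_inner_add_sub_eq_zero_iff, hu, hv])
  have h1 : ∀ z : E, inner ℝ (u + v) z * inner ℝ (u - v) z =
      inner ℝ u z * inner ℝ u z - inner ℝ v z * inner ℝ v z := by
    intro z
    rw [inner_add_left, inner_sub_left]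
    ring
  simp only [h1] at h
  rw [integral_sub (integrableOn_unitBall (by fun_prop)) (integrableOn_unitBall (by fun_prop))] at h
  linarith

/-- The moment is given a positive value, without meaning, when `F` has no unit vector. -/
lemma exists_unitBall_moment (F : Type*) [NormedAddCommGroup F] [InnerProductSpace ℝ F]
    [FiniteDimensional ℝ F] [MeasurableSpace F] [BorelSpace F] :
    ∃ M > 0, ∀ f : F, ‖f‖ = 1 →
      ∫ z in Metric.closedBall (0 : F) 1, inner ℝ f z * inner ℝ f z = M := by
  by_cases h : ∃ f : F, ‖f‖ = 1
  · obtain ⟨f, hf⟩ := h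
    refine ⟨_, ?_, fun g hg => setIntegral_inner_sq_eq hg hf⟩
    refine setIntegral_unitBall_pos (integrableOn_unitBall (by fun_prop))
      (fun z => mul_self_nonneg _) ?_
    filter_upwards [ae_inner_ne_zero (show f ≠ 0 by rintro rfl; simp at hf)] with z hz
    exact mul_self_ne_zero.2 hz
  · exact ⟨1, one_pos, fun f hf => (h ⟨f, hf⟩).elim⟩

/-- The asymptotics behind the median of a quadratic polynomial with nonzero gradient. -/
lemma tendsto_setIntegral_signedPow_of_eq_one {e : E} (he : ‖e‖ = 1)
    (A : E →L[ℝ] E) : ∃ β > 0, ∃ K > 0, ∀ c : ℝ,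
      Tendsto (fun t : ℝ => t⁻¹ * ∫ z in Metric.closedBall (0 : E) 1,
        signedPow 1 (inner ℝ e z + t * (1 / 2 * inner ℝ (A z) z - c))) (𝓝[>] 0)
      (𝓝 (K * (β * (LinearMap.trace ℝ E A + (1 - 2) * inner ℝ (A e) e) - c))) := by
  obtain ⟨M, hMpos, hM⟩ := exists_unitBall_moment (ℝ ∙ e)ᗮ
  obtain ⟨u, b, i₀, hb⟩ := exists_orthonormalBasis_of_norm_eq_one he
  have horth : ∀ i, i ≠ i₀ → b i ∈ (ℝ ∙ e)ᗮ := fun i hi =>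
    Submodule.mem_orthogonal_singleton_iff_inner_right.2
      (by rw [← hb]; exact b.orthonormal.2 hi.symm)
  have hzero : ∀ y : (ℝ ∙ e)ᗮ, inner ℝ (b i₀) (y : E) = 0 := fun y => by
    rw [hb]; exact Submodule.mem_orthogonal_singleton_iff_inner_right.1 y.2
  have hquad : ∫ y in Metric.closedBall (0 : (ℝ ∙ e)ᗮ) 1, 1 * inner ℝ (A (y : E)) (y : E) =
      M * (LinearMap.trace ℝ E A + (1 - 2) * inner ℝ (A e) e) := by
    rw [show inner ℝ (A e) e = inner ℝ (A (b i₀)) (b i₀) by rw [hb]]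
    refine integral_quadratic_of_moments (ω := fun _ => 1) (X := fun y : (ℝ ∙ e)ᗮ => (y : E)) b i₀
      ?_ ?_ ?_ ?_ A
    · exact fun i j => integrableOn_unitBall (by fun_prop)
    · intro i j hij
      simp only [one_mul]
      by_cases hi : i = i₀
      · simp [hi, hzero]
      by_cases hj : j = i₀
      · simp [hj, hzero]
      exact setIntegral_inner_mul_inner_eq_zero (u := (⟨b i, horth i hi⟩ : (ℝ ∙ e)ᗮ))
        (v := ⟨b j, horth j hj⟩) (b.orthonormal.2 hij)
    · simp [hzero]
    · intro i hi
      simp only [one_mul]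
      exact hM ⟨b i, horth i hi⟩ (b.orthonormal.1 i)
  set V := ∫ _y in Metric.closedBall (0 : (ℝ ∙ e)ᗮ) 1, (1 : ℝ) with hV
  have hVpos : 0 < V := setIntegral_unitBall_pos (integrableOn_unitBall continuous_const)
    (fun _ => zero_le_one) (ae_of_all _ fun _ => one_ne_zero)
  refine ⟨M / (2 * V), by positivity, 2 * V, by positivity, fun c => ?_⟩
  have h := tendsto_setIntegral_signedPow_one_slope he
    (w := fun z => 1 / 2 * inner ℝ (A z) z - c) (by fun_prop)
  convert h using 2
  have h1 : ∀ y : (ℝ ∙ e)ᗮ, 2 * (1 / 2 * inner ℝ (A (y : E)) (y : E) - c) =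
      1 * inner ℝ (A (y : E)) (y : E) - 2 * c * 1 := by
    intro y; ring
  simp only [h1]
  rw [integral_sub (integrableOn_unitBall (by fun_prop)) (integrableOn_unitBall (by fun_prop)),
    hquad, integral_const_mul, ← hV]
  field_simp

/-- The derivative at `0` of the integral of `|⟨ξ, z⟩ + t (½⟨A z, z⟩ - c)|^(p-2) (⟨ξ, z⟩ + …)` over
the unit ball has the sign of `β Δ - c`, where `Δ` is the normalized `p`-Laplacian. -/
lemma tendsto_setIntegral_signedPow {p : ℝ} (hp : 1 ≤ p) {ξ : E} (hξ : ξ ≠ 0)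
    (A : E →L[ℝ] E) : ∃ β > 0, ∃ K > 0, ∀ c : ℝ,
      Tendsto (fun t : ℝ => t⁻¹ * ∫ z in Metric.closedBall (0 : E) 1,
        signedPow p (inner ℝ ξ z + t * (1 / 2 * inner ℝ (A z) z - c))) (𝓝[>] 0)
      (𝓝 (K * (β * (LinearMap.trace ℝ E A + (p - 2) * (inner ℝ (A ξ) ξ / ‖ξ‖ ^ 2)) - c))) := by
  -- Homogeneity of the signed power reduces the claim to a unit vector, with `A / |ξ|` for `A`.
  have hr : 0 < ‖ξ‖ := norm_pos_iff.2 hξ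
  set r := ‖ξ‖
  have he : ‖r⁻¹ • ξ‖ = 1 := by
    rw [norm_smul, norm_inv, Real.norm_of_nonneg hr.le, inv_mul_cancel₀ hr.ne']
  obtain ⟨β, hβ, K, hK, h⟩ : ∃ β > 0, ∃ K > 0, ∀ c : ℝ,
      Tendsto (fun t : ℝ => t⁻¹ * ∫ z in Metric.closedBall (0 : E) 1,
        signedPow p (inner ℝ (r⁻¹ • ξ) z + t * (1 / 2 * inner ℝ ((r⁻¹ • A) z) z - c))) (𝓝[>] 0)
      (𝓝 (K * (β * (LinearMap.trace ℝ E (r⁻¹ • A : E →L[ℝ] E) +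
        (p - 2) * inner ℝ ((r⁻¹ • A) (r⁻¹ • ξ)) (r⁻¹ • ξ)) - c))) := by
    rcases hp.eq_or_lt with rfl | hp
    · exact tendsto_setIntegral_signedPow_of_eq_one he _
    · exact tendsto_setIntegral_signedPow_of_one_lt hp he _
  refine ⟨β, hβ, r ^ (p - 1) * K * r⁻¹, by positivity, fun c => ?_⟩
  convert (h (r⁻¹ * c)).const_mul (r ^ (p - 1)) using 2 with t
  · rw [mul_left_comm, ← integral_const_mul (r ^ (p - 1))]
    congr 2
    ext z
    rw [← signedPow.mul_left p hr]
    congr 1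
    simp only [inner_smul_left, smul_apply, RCLike.conj_to_real]
    field_simp
  · have h1 : LinearMap.trace ℝ E (r⁻¹ • A : E →L[ℝ] E) = r⁻¹ * LinearMap.trace ℝ E A := by
      rw [ContinuousLinearMap.toLinearMap_smul, map_smul, smul_eq_mul]
    rw [h1]
    simp only [inner_smul_left, inner_smul_right, smul_apply, map_smul,
      RCLike.conj_to_real]
    field_simp

end InnerProductSpace

/-! ### Second-order Taylor expansions -/

section SecondOrderExpansion

lemma eventually_forall_norm_le {E : Type*} [NormedAddCommGroup E] {P : E → Prop} (h : ∀ᶠ y in 𝓝 0, P y) :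
    ∀ᶠ ε : ℝ in 𝓝[>] 0, ∀ y, ‖y‖ ≤ ε → P y := by
  obtain ⟨r, hr, hP⟩ := Metric.eventually_nhds_iff.1 h
  filter_upwards [Ioo_mem_nhdsGT hr] with ε hε y hy
  exact hP (by rw [dist_zero_right]; exact hy.trans_lt hε.2)

variable {E : Type*} [NormedAddCommGroup E] [InnerProductSpace ℝ E]

/-- `φ` has at `x` a second-order Taylor expansion with gradient `ξ` and Hessian `A`; the
remainder is `o(|h|²)`. -/
def HasSecondOrderExpansion (φ : E → ℝ) (x ξ : E) (A : E →L[ℝ] E) : Prop :=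
  ∀ η > 0, ∀ᶠ h : E in 𝓝 0,
    |φ (x + h) - φ x - inner ℝ ξ h - 1 / 2 * inner ℝ (A h) h| ≤ η * ‖h‖ ^ 2

open Classical in
/-- The normalized `p`-Laplacian as a function of the Hessian `A` and of the gradient `ξ ≠ 0`. -/
noncomputable def hessianPLaplacian (p : ℝ≥0∞) (A : E →L[ℝ] E) (ξ : E) : ℝ :=
  if p = ∞ then inner ℝ (A ξ) ξ / ‖ξ‖ ^ 2
  else LinearMap.trace ℝ E A + (p.toReal - 2) * (inner ℝ (A ξ) ξ / ‖ξ‖ ^ 2)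

/-- The operator is odd under `φ ↦ -φ`; this is how lower bounds for `p`-means are reduced to upper
bounds. -/
lemma hessianPLaplacian_neg (p : ℝ≥0∞) (A : E →L[ℝ] E) (ξ : E) :
    hessianPLaplacian p (-A) (-ξ) = -hessianPLaplacian p A ξ := by
  have h : inner ℝ ((-A) (-ξ)) (-ξ) / ‖-ξ‖ ^ 2 = -(inner ℝ (A ξ) ξ / ‖ξ‖ ^ 2) := by
    simp [neg_div]
  unfold hessianPLaplacian
  rw [h]
  split_ifs
  · rfl
  · rw [ContinuousLinearMap.toLinearMap_neg, map_neg]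
    ring

lemma HasSecondOrderExpansion.neg {φ : E → ℝ} {x ξ : E} {A : E →L[ℝ] E}
    (h : HasSecondOrderExpansion φ x ξ A) :
    HasSecondOrderExpansion (fun y => -φ y) x (-ξ) (-A) := by
  intro η hη
  filter_upwards [h η hη] with y hy
  rw [← abs_neg]
  convert hy using 2
  simp
  ring

lemma hasSecondOrderExpansion_of_contDiffAt [CompleteSpace E] {φ : E → ℝ} {x : E} (hφ : ContDiffAt ℝ 2 φ x) :
    DifferentiableAt ℝ (gradient φ) x ∧
      HasSecondOrderExpansion φ x (gradient φ x) (fderiv ℝ (gradient φ) x) := by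
  have hd : DifferentiableAt ℝ (gradient φ) x := by
    have h1 : DifferentiableAt ℝ (fderiv ℝ φ) x :=
      (hφ.fderiv_right (m := 1) (by norm_num)).differentiableAt (by norm_num)
    exact ((InnerProductSpace.toDual ℝ E).symm.toContinuousLinearEquiv.differentiableAt).comp x h1
  refine ⟨hd, fun η hη => ?_⟩
  set A := fderiv ℝ (gradient φ) x
  have hgrad : ∀ᶠ y in 𝓝 x, HasGradientAt φ (gradient φ y) y := by
    filter_upwards [hφ.eventually (by simp)] with y hy
    exact (hy.differentiableAt (by norm_num)).hasGradientAt
  have hA : ∀ᶠ h : E in 𝓝 0, ‖gradient φ (x + h) - gradient φ x - A h‖ ≤ η * ‖h‖ :=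
    (hasFDerivAt_iff_isLittleO_nhds_zero.1 hd.hasFDerivAt).def hη
  have hgrad' : ∀ᶠ h : E in 𝓝 0, HasGradientAt φ (gradient φ (x + h)) (x + h) := by
    have : Tendsto (fun h : E => x + h) (𝓝 0) (𝓝 x) := by
      have hc : Continuous fun h : E => x + h := by fun_prop
      simpa using hc.tendsto 0
    exact this.eventually hgrad
  obtain ⟨r, hr, hball⟩ := Metric.eventually_nhds_iff_ball.1 (hA.and hgrad')
  filter_upwards [Metric.ball_mem_nhds (0 : E) hr] with h hh
  rw [mem_ball_zero_iff] at hh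
  -- The mean value inequality along the segment from `x` to `x + h`.
  have hmem : ∀ t ∈ Set.Icc (0 : ℝ) 1, t • h ∈ Metric.ball (0 : E) r := by
    intro t ht
    rw [mem_ball_zero_iff, norm_smul, Real.norm_of_nonneg ht.1]
    exact (mul_le_of_le_one_left (norm_nonneg h) ht.2).trans_lt hh
  have hder : ∀ t ∈ Set.Icc (0 : ℝ) 1, HasDerivWithinAt
      (fun t : ℝ => φ (x + t • h) - t * inner ℝ (gradient φ x) h - t ^ 2 * (1 / 2 * inner ℝ (A h) h))
      (inner ℝ (gradient φ (x + t • h) - gradient φ x - A (t • h)) h) (Set.Icc 0 1) t := by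
    intro t ht
    have h1 : HasDerivAt (fun t : ℝ => x + t • h) h t := by
      simpa using ((hasDerivAt_id t).smul_const h).const_add x
    have h2 := ((hball _ (hmem t ht)).2.hasFDerivAt).comp_hasDerivAt t h1
    have h3 := (h2.sub ((hasDerivAt_id t).mul_const (inner ℝ (gradient φ x) h))).sub
      (((hasDerivAt_id t).pow 2).mul_const (1 / 2 * inner ℝ (A h) h))
    refine (h3.congr_deriv ?_).hasDerivWithinAt
    simp [inner_sub_left, inner_smul_left]
    ring
  have hbd : ∀ t ∈ Set.Ico (0 : ℝ) 1,
      ‖(inner ℝ (gradient φ (x + t • h) - gradient φ x - A (t • h)) h : ℝ)‖ ≤ η * ‖h‖ ^ 2 := by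
    intro t ht
    refine (norm_inner_le_norm _ _).trans ?_
    have h1 := (hball _ (hmem t ⟨ht.1, ht.2.le⟩)).1
    rw [norm_smul, Real.norm_of_nonneg ht.1] at h1
    have h2 : t * ‖h‖ ≤ ‖h‖ := mul_le_of_le_one_left (norm_nonneg h) ht.2.le
    calc _ ≤ η * ‖h‖ * ‖h‖ := by
          gcongr
          exact h1.trans (by gcongr)
      _ = _ := by ring
  have := norm_image_sub_le_of_norm_deriv_le_segment' hder hbd 1 (by simp)
  simp only [Real.norm_eq_abs, one_smul, zero_smul, add_zero, one_mul, zero_mul, one_pow, sub_zero,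
    mul_one] at this
  convert this using 2
  ring

lemma ContDiffAt.eventually_continuousOn_closedBall {φ : E → ℝ} {x : E} (hφ : ContDiffAt ℝ 2 φ x) :
    ∀ᶠ ε : ℝ in 𝓝[>] 0, ContinuousOn φ (Metric.closedBall x ε) := by
  obtain ⟨r, hr, hball⟩ := Metric.eventually_nhds_iff_ball.1 (hφ.eventually (by simp))
  filter_upwards [Ioo_mem_nhdsGT hr] with ε hε y hy
  exact (hball y (Metric.closedBall_subset_ball hε.2 hy)).continuousAt.continuousWithinAt

end SecondOrderExpansion

/-! ### Asymptotics of the `p`-mean -/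

section Asymptotics

lemma setIntegral_closedBall_comp_smul_sub {E : Type*} [NormedAddCommGroup E]
    [InnerProductSpace ℝ E] [FiniteDimensional ℝ E] [MeasurableSpace E] [BorelSpace E]
    (f : E → ℝ) (x : E) {ε : ℝ} (hε : 0 < ε) :
    ∫ y in Metric.closedBall x ε, f (ε⁻¹ • (y - x)) =
      ε ^ Module.finrank ℝ E * ∫ z in Metric.closedBall (0 : E) 1, f z := by
  have h1 := (measurePreserving_add_left (volume : Measure E) x).setIntegral_preimage_emb
    (measurableEmbedding_addLeft x) (fun y => f (ε⁻¹ • (y - x))) (Metric.closedBall x ε)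
  have h2 : (fun y => x + y) ⁻¹' Metric.closedBall x ε = Metric.closedBall (0 : E) ε := by
    ext y; simp
  rw [← h1, h2]
  simp only [add_sub_cancel_left]
  rw [Measure.setIntegral_comp_smul_of_pos _ _ _ (inv_pos.2 hε), smul_closedBall _ _ hε.le,
    smul_zero, Real.norm_of_nonneg (inv_nonneg.2 hε.le), inv_mul_cancel₀ hε.ne', inv_pow, inv_inv,
    smul_eq_mul]

variable {N : ℕ} {p : ℝ≥0∞} {φ : EuclideanSpace ℝ (Fin N) → ℝ} {x ξ : EuclideanSpace ℝ (Fin N)}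
  {A : EuclideanSpace ℝ (Fin N) →L[ℝ] EuclideanSpace ℝ (Fin N)}

/-- Upper bound for the `p`-mean, `p < ∞`: slightly above the predicted value, the sign of
`∫ |φ - l|^(p-2) (φ - l)` is the one given by `tendsto_setIntegral_signedPow`. -/
lemma HasSecondOrderExpansion.isPMean_le_of_ne_top (hp : 1 ≤ p) (hp' : p ≠ ∞)
    (hφ : HasSecondOrderExpansion φ x ξ A) (hξ : ξ ≠ 0)
    (hcont : ∀ᶠ ε : ℝ in 𝓝[>] 0, ContinuousOn φ (Metric.closedBall x ε)) :
    ∃ β > 0, ∀ δ > 0, ∀ᶠ ε : ℝ in 𝓝[>] 0, ∀ m, IsPMean p ε φ x m →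
      m ≤ φ x + ε ^ 2 * (β * hessianPLaplacian p A ξ + δ) := by
  have hq : 1 ≤ p.toReal := by
    rw [← ENNReal.toReal_one]; exact ENNReal.toReal_mono hp' hp
  obtain ⟨β, hβ, K, hK, hlim⟩ := tendsto_setIntegral_signedPow hq hξ A
  refine ⟨β, hβ, fun δ hδ => ?_⟩
  -- Half of `δ` absorbs the Taylor remainder, the other half makes the limit strictly negative.
  have hL : hessianPLaplacian p A ξ =
      LinearMap.trace ℝ (EuclideanSpace ℝ (Fin N)) A + (p.toReal - 2) * (inner ℝ (A ξ) ξ / ‖ξ‖ ^ 2) := if_neg hp'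
  rw [← hL] at hlim
  set c := β * hessianPLaplacian p A ξ + δ / 2 with hc
  have hneg : K * (β * hessianPLaplacian p A ξ - c) < 0 :=
    mul_neg_of_pos_of_neg hK (by linarith)
  filter_upwards [(hlim c).eventually (gt_mem_nhds hneg), hcont, self_mem_nhdsWithin,
    eventually_forall_norm_le (hφ (δ / 2) (by linarith))] with ε h1 h2 h3 h4 m hm
  have h3 : 0 < ε := h3
  refine hm.le_of_integral_signedPow_neg hp hp' h2 ?_
  set w : EuclideanSpace ℝ (Fin N) → ℝ := fun z =>
    inner ℝ ξ z + ε * (1 / 2 * inner ℝ (A z) z - c) with hw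
  have hwc : Continuous fun y => ε * w (ε⁻¹ • (y - x)) := by
    rw [hw]; fun_prop
  have hle : ∀ y ∈ Metric.closedBall x ε,
      φ y - (φ x + ε ^ 2 * (β * hessianPLaplacian p A ξ + δ)) ≤ ε * w (ε⁻¹ • (y - x)) - 0 := by
    intro y hy
    have hy : ‖y - x‖ ≤ ε := by rwa [mem_closedBall_iff_norm] at hy
    have h5 := (abs_le.1 (h4 (y - x) hy)).2
    rw [add_sub_cancel] at h5
    have h6 : δ / 2 * ‖y - x‖ ^ 2 ≤ δ / 2 * ε ^ 2 := by gcongr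
    have h7 : ε * w (ε⁻¹ • (y - x)) =
        inner ℝ ξ (y - x) + 1 / 2 * inner ℝ (A (y - x)) (y - x) - ε ^ 2 * c := by
      simp only [hw, map_smul, inner_smul_left, inner_smul_right, RCLike.conj_to_real]
      field_simp
      ring
    rw [h7, hc]
    linarith
  calc ∫ y in Metric.closedBall x ε,
        signedPow p.toReal (φ y - (φ x + ε ^ 2 * (β * hessianPLaplacian p A ξ + δ)))
      ≤ ∫ y in Metric.closedBall x ε, signedPow p.toReal (ε * w (ε⁻¹ • (y - x)) - 0) :=
        setIntegral_mono_on (integrableOn_signedPow_sub hq h2 _)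
          (integrableOn_signedPow_sub hq hwc.continuousOn 0)
          Metric.isClosed_closedBall.measurableSet
          fun y hy => signedPow.monotone hq (hle y hy)
    _ = ε ^ Module.finrank ℝ (EuclideanSpace ℝ (Fin N)) *
        ∫ z in Metric.closedBall (0 : EuclideanSpace ℝ (Fin N)) 1,
          signedPow p.toReal (ε * w z) := by
        simp only [sub_zero]
        exact setIntegral_closedBall_comp_smul_sub (fun z => signedPow p.toReal (ε * w z)) x h3
    _ = ε ^ Module.finrank ℝ (EuclideanSpace ℝ (Fin N)) * (ε ^ (p.toReal - 1) *
        ∫ z in Metric.closedBall (0 : EuclideanSpace ℝ (Fin N)) 1, signedPow p.toReal (w z)) := by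
        simp only [signedPow.mul_left _ h3, integral_const_mul]
    _ < 0 := by
        rw [inv_mul_lt_iff₀ h3, mul_zero] at h1
        exact mul_neg_of_pos_of_neg (by positivity) (mul_neg_of_pos_of_neg (by positivity) h1)

/-- On the unit ball, a linear form perturbed by a small quadratic form is almost maximal at the
unit vector representing the linear form. -/
lemma inner_add_quadratic_le {E : Type*} [NormedAddCommGroup E] [InnerProductSpace ℝ E]
    (A : E →L[ℝ] E) {e z : E} (he : ‖e‖ = 1) (hz : ‖z‖ ≤ 1) {r t : ℝ} (hr : 0 < r) (ht : 0 ≤ t) :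
    r * inner ℝ e z + t * (1 / 2 * inner ℝ (A z) z) ≤
      r + t * (1 / 2 * inner ℝ (A e) e) + t ^ 2 * (‖A‖ ^ 2 / (2 * r)) := by
  -- The linear form drops by `r d² / 2` at distance `d` from `e`, while the quadratic form varies by
  -- at most `‖A‖ d`; complete the square.
  set d := ‖z - e‖
  have h1 : inner ℝ e z ≤ 1 - d ^ 2 / 2 := by
    have h := norm_sub_sq_real z e
    have hz2 : ‖z‖ ^ 2 ≤ 1 := pow_le_one₀ (norm_nonneg z) hz
    rw [he, real_inner_comm] at h
    linarith
  have h2 : inner ℝ (A z) z - inner ℝ (A e) e ≤ 2 * (‖A‖ * d) := by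
    have h3 : inner ℝ (A z) z - inner ℝ (A e) e = inner ℝ (A (z - e)) z + inner ℝ (A e) (z - e) := by
      rw [map_sub, inner_sub_left, inner_sub_right]
      ring
    have h4 : inner ℝ (A (z - e)) z ≤ ‖A‖ * d := by
      refine (real_inner_le_norm _ _).trans ?_
      calc ‖A (z - e)‖ * ‖z‖ ≤ (‖A‖ * d) * 1 := by
            gcongr
            exact A.le_opNorm _
        _ = _ := mul_one _
    have h5 : inner ℝ (A e) (z - e) ≤ ‖A‖ * d := by
      refine (real_inner_le_norm _ _).trans ?_
      have := A.le_opNorm e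
      rw [he, mul_one] at this
      gcongr
    linarith
  have h6 : r * inner ℝ e z ≤ r * (1 - d ^ 2 / 2) := by gcongr
  have h7 : t * (inner ℝ (A z) z - inner ℝ (A e) e) ≤ t * (2 * (‖A‖ * d)) := by gcongr
  have h8 : t * (‖A‖ * d) - r * (d ^ 2 / 2) ≤ t ^ 2 * (‖A‖ ^ 2 / (2 * r)) := by
    have h9 : t ^ 2 * (‖A‖ ^ 2 / (2 * r)) - (t * (‖A‖ * d) - r * (d ^ 2 / 2)) =
        (t * ‖A‖ - r * d) ^ 2 / (2 * r) := by
      field_simp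
      ring
    have : 0 ≤ (t * ‖A‖ - r * d) ^ 2 / (2 * r) := by positivity
    linarith
  linarith

/-- Upper bound for the midrange: the maximum over the ball is estimated by
`inner_add_quadratic_le`, the minimum by the value at `x - ε ξ / |ξ|`. -/
lemma HasSecondOrderExpansion.isPMean_top_le (hφ : HasSecondOrderExpansion φ x ξ A) (hξ : ξ ≠ 0)
    (hcont : ∀ᶠ ε : ℝ in 𝓝[>] 0, ContinuousOn φ (Metric.closedBall x ε)) {δ : ℝ} (hδ : 0 < δ) :
    ∀ᶠ ε : ℝ in 𝓝[>] 0, ∀ m, IsPMean ∞ ε φ x m →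
      m ≤ φ x + ε ^ 2 * (1 / 2 * hessianPLaplacian ∞ A ξ + δ) := by
  have hr : 0 < ‖ξ‖ := norm_pos_iff.2 hξ
  set r := ‖ξ‖ with hrdef
  set e := r⁻¹ • ξ with hedef
  have he : ‖e‖ = 1 := by
    rw [hedef, norm_smul, norm_inv, Real.norm_of_nonneg hr.le, inv_mul_cancel₀ hr.ne']
  have hξe : ξ = r • e := by rw [hedef, smul_inv_smul₀ hr.ne']
  have hL : hessianPLaplacian ∞ A ξ = inner ℝ (A e) e := by
    rw [hessianPLaplacian, if_pos rfl, ← hrdef, hedef]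
    simp only [map_smul, inner_smul_left, inner_smul_right, RCLike.conj_to_real]
    field_simp
  have hsmall : ∀ᶠ ε : ℝ in 𝓝[>] 0, ε * (‖A‖ ^ 2 / (2 * r)) < δ / 2 := by
    have hc : Continuous fun ε : ℝ => ε * (‖A‖ ^ 2 / (2 * r)) := by fun_prop
    have h := hc.tendsto 0
    rw [zero_mul] at h
    exact (h.mono_left nhdsWithin_le_nhds).eventually (gt_mem_nhds (by linarith))
  filter_upwards [hcont, self_mem_nhdsWithin, hsmall,
    eventually_forall_norm_le (hφ (δ / 2) (by linarith))] with ε h1 h2 h3 h4 m hm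
  have h2 : 0 < ε := h2
  rw [hL]
  obtain ⟨y₀, hy₀, y₁, hy₁, hmin, hmax⟩ := exists_isMinMax_closedBall h2 h1
  rw [hm.eq_midrange h2 h1 hy₀ hy₁ hmin hmax]
  have hup : φ y₁ ≤ φ x + ε * r + ε ^ 2 * (1 / 2 * inner ℝ (A e) e + δ) := by
    rw [mem_closedBall_iff_norm] at hy₁
    have h5 := (abs_le.1 (h4 (y₁ - x) hy₁)).2
    rw [add_sub_cancel] at h5
    have h6 : δ / 2 * ‖y₁ - x‖ ^ 2 ≤ δ / 2 * ε ^ 2 := by gcongr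
    have hz : ‖ε⁻¹ • (y₁ - x)‖ ≤ 1 := by
      rw [norm_smul, norm_inv, Real.norm_of_nonneg h2.le, inv_mul_le_iff₀ h2, mul_one]
      exact hy₁
    have h7 := mul_le_mul_of_nonneg_left (inner_add_quadratic_le A he hz hr h2.le) h2.le
    have h8 : ε * (r * inner ℝ e (ε⁻¹ • (y₁ - x)) +
        ε * (1 / 2 * inner ℝ (A (ε⁻¹ • (y₁ - x))) (ε⁻¹ • (y₁ - x)))) =
        inner ℝ ξ (y₁ - x) + 1 / 2 * inner ℝ (A (y₁ - x)) (y₁ - x) := by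
      rw [hξe]
      simp only [map_smul, inner_smul_left, inner_smul_right, RCLike.conj_to_real]
      field_simp
    have h9 : ε ^ 2 * (ε * (‖A‖ ^ 2 / (2 * r))) ≤ ε ^ 2 * (δ / 2) := by gcongr
    rw [h8] at h7
    linarith
  have hlow : φ y₀ ≤ φ x - ε * r + ε ^ 2 * (1 / 2 * inner ℝ (A e) e + δ / 2) := by
    have hn : ‖-(ε • e)‖ = ε := by
      rw [norm_neg, norm_smul, he, Real.norm_of_nonneg h2.le, mul_one]
    refine (hmin (x + -(ε • e)) (by rw [mem_closedBall_iff_norm, add_sub_cancel_left, hn])).trans ?_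
    have h5 := (abs_le.1 (h4 (-(ε • e)) hn.le)).2
    rw [hn] at h5
    have h6 : inner ℝ ξ (-(ε • e)) = -(ε * r) := by
      rw [hξe, inner_neg_right, inner_smul_left, inner_smul_right, real_inner_self_eq_norm_sq, he]
      simp
      ring
    have h7 : inner ℝ (A (-(ε • e))) (-(ε • e)) = ε ^ 2 * inner ℝ (A e) e := by
      simp only [map_neg, map_smul, inner_neg_left, inner_neg_right, inner_smul_left,
        inner_smul_right, RCLike.conj_to_real]
      ring
    rw [h6, h7] at h5
    linarith
  have : 0 ≤ ε ^ 2 * (δ / 2) := by positivity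
  linarith

lemma HasSecondOrderExpansion.isPMean_le (hp : 1 ≤ p)
    (hφ : HasSecondOrderExpansion φ x ξ A) (hξ : ξ ≠ 0)
    (hcont : ∀ᶠ ε : ℝ in 𝓝[>] 0, ContinuousOn φ (Metric.closedBall x ε)) :
    ∃ β > 0, ∀ δ > 0, ∀ᶠ ε : ℝ in 𝓝[>] 0, ∀ m, IsPMean p ε φ x m →
      m ≤ φ x + ε ^ 2 * (β * hessianPLaplacian p A ξ + δ) := by
  by_cases hp' : p = ∞
  · subst hp'
    exact ⟨1 / 2, by norm_num, fun δ hδ => hφ.isPMean_top_le hξ hcont hδ⟩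
  · exact hφ.isPMean_le_of_ne_top hp hp' hξ hcont

lemma normalizedPLaplacian_eq_hessianPLaplacian (hd : DifferentiableAt ℝ (gradient φ) x)
    (h0 : gradient φ x ≠ 0) :
    normalizedPLaplacian p φ x =
      hessianPLaplacian p (fderiv ℝ (gradient φ) x) (gradient φ x) := by
  unfold normalizedPLaplacian hessianPLaplacian
  split_ifs with hp
  · rfl
  set G := gradient φ
  set B := fderiv ℝ G x
  set q := p.toReal - 2
  have hpos : 0 < ‖G x‖ := norm_pos_iff.2 h0
  -- Powers of the squared norm, whose derivative is given by the inner product.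
  have hnorm : ∀ y, ‖G y‖ ^ q = (‖G y‖ ^ 2) ^ (q / 2) := by
    intro y
    rw [← Real.rpow_natCast, ← Real.rpow_mul (norm_nonneg _)]
    congr 1
    push_cast
    ring
  have hc : HasFDerivAt (fun y => ‖G y‖ ^ q)
      ((q / 2 * (‖G x‖ ^ 2) ^ (q / 2 - 1)) • (2 • (innerSL ℝ (G x)).comp B)) x := by
    simp only [hnorm]
    exact hd.hasFDerivAt.norm_sq.rpow_const (Or.inl (by positivity))
  have hF : fderiv ℝ (fun y => ‖G y‖ ^ q • G y) x = _ := (hc.smul hd.hasFDerivAt).fderiv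
  have hsum : ∑ i : Fin N, G x i * inner ℝ (G x) (B (EuclideanSpace.single i 1)) =
      inner ℝ (B (G x)) (G x) := by
    have hs : ∑ i : Fin N, G x i • EuclideanSpace.single i (1 : ℝ) = G x := by
      simpa using (EuclideanSpace.basisFun (Fin N) ℝ).sum_repr (G x)
    have hB : B (G x) = ∑ i : Fin N, G x i • B (EuclideanSpace.single i 1) := by
      conv_lhs => rw [← hs]
      simp only [map_sum, map_smul]
    rw [hB, sum_inner]
    refine Finset.sum_congr rfl fun i _ => ?_
    rw [real_inner_smul_left, real_inner_comm]
  have htr : LinearMap.trace ℝ _ (B : EuclideanSpace ℝ (Fin N) →ₗ[ℝ] EuclideanSpace ℝ (Fin N)) =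
      ∑ i : Fin N, B (EuclideanSpace.single i 1) i := by
    rw [LinearMap.trace_eq_sum_inner _ (EuclideanSpace.basisFun (Fin N) ℝ)]
    simp [EuclideanSpace.inner_single_left]
  have hpow : (‖G x‖ ^ 2) ^ (q / 2 - 1) = ‖G x‖ ^ q / ‖G x‖ ^ 2 := by
    rw [Real.rpow_sub_one (by positivity), ← hnorm]
  have hterm : ∀ i : Fin N, (fderiv ℝ (fun y => ‖G y‖ ^ q • G y) x (EuclideanSpace.single i 1)) i =
      ‖G x‖ ^ q * B (EuclideanSpace.single i 1) i + q * (‖G x‖ ^ q / ‖G x‖ ^ 2) *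
        (G x i * inner ℝ (G x) (B (EuclideanSpace.single i 1))) := by
    intro i
    rw [hF, hpow]
    simp
    ring
  rw [divergence]
  simp only [hterm]
  rw [Finset.sum_add_distrib, ← Finset.mul_sum, ← Finset.mul_sum, hsum, ← htr]
  have : ‖G x‖ ^ q ≠ 0 := by positivity
  field_simp

lemma pMean_sub_le (hp : 1 ≤ p) (hφ : ContDiffAt ℝ 2 φ x) (h0 : gradient φ x ≠ 0) :
    ∃ β > 0, ∀ δ > 0, ∀ᶠ ε : ℝ in 𝓝[>] 0,
      pMean p ε φ x - φ x ≤ ε ^ 2 * (β * normalizedPLaplacian p φ x + δ) := by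
  obtain ⟨hd, hexp⟩ := hasSecondOrderExpansion_of_contDiffAt hφ
  have hcont := hφ.eventually_continuousOn_closedBall
  obtain ⟨β, hβ, h⟩ := hexp.isPMean_le hp h0 hcont
  refine ⟨β, hβ, fun δ hδ => ?_⟩
  rw [normalizedPLaplacian_eq_hessianPLaplacian hd h0]
  filter_upwards [h δ hδ, hcont, self_mem_nhdsWithin] with ε h1 h2 h3
  have := h1 _ (isPMean_pMean hp h3 h2)
  linarith

/-- The constant `β` need not be the one of `pMean_sub_le`; only its sign is used. -/
lemma le_pMean_sub (hp : 1 ≤ p) (hφ : ContDiffAt ℝ 2 φ x) (h0 : gradient φ x ≠ 0) :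
    ∃ β > 0, ∀ δ > 0, ∀ᶠ ε : ℝ in 𝓝[>] 0,
      ε ^ 2 * (β * normalizedPLaplacian p φ x - δ) ≤ pMean p ε φ x - φ x := by
  obtain ⟨hd, hexp⟩ := hasSecondOrderExpansion_of_contDiffAt hφ
  have hcont := hφ.eventually_continuousOn_closedBall
  obtain ⟨β, hβ, h⟩ := hexp.neg.isPMean_le hp (neg_ne_zero.2 h0)
    (hcont.mono fun ε h => h.neg)
  refine ⟨β, hβ, fun δ hδ => ?_⟩
  rw [normalizedPLaplacian_eq_hessianPLaplacian hd h0]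
  filter_upwards [h δ hδ, hcont, self_mem_nhdsWithin] with ε h1 h2 h3
  have := h1 _ (isPMean_pMean hp h3 h2).neg
  rw [hessianPLaplacian_neg] at this
  linarith

/-- If `m ε = β L ε² + o(ε²)` with `β > 0`, then `L ≤ 0` says exactly that `m ≤ o(ε²)`. The two
one-sided bounds may come with different `β`. -/
lemma nonpos_iff_exists_isLittleO {m : ℝ → ℝ} {L : ℝ}
    (hup : ∃ β > 0, ∀ δ > 0, ∀ᶠ ε : ℝ in 𝓝[>] 0, m ε ≤ ε ^ 2 * (β * L + δ))
    (hlow : ∃ β > 0, ∀ δ > 0, ∀ᶠ ε : ℝ in 𝓝[>] 0, ε ^ 2 * (β * L - δ) ≤ m ε) :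
    L ≤ 0 ↔ ∃ r : ℝ → ℝ, r =o[𝓝[>] (0 : ℝ)] (fun ε : ℝ => ε ^ 2) ∧
      ∀ᶠ ε in 𝓝[>] (0 : ℝ), m ε + r ε ≤ 0 := by
  constructor
  · intro hL
    obtain ⟨β, hβ, hup⟩ := hup
    refine ⟨fun ε => -max 0 (m ε), ?_, Eventually.of_forall fun ε => ?_⟩
    · rw [isLittleO_iff]
      intro δ hδ
      filter_upwards [hup δ hδ] with ε hε
      have h1 : ε ^ 2 * (β * L + δ) ≤ δ * ε ^ 2 := by
        have : β * L ≤ 0 := mul_nonpos_of_nonneg_of_nonpos hβ.le hL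
        nlinarith [sq_nonneg ε]
      rw [norm_neg, Real.norm_of_nonneg (le_max_left _ _), Real.norm_of_nonneg (sq_nonneg ε)]
      exact max_le (by positivity) (hε.trans h1)
    · have := le_max_right 0 (m ε)
      linarith
  · rintro ⟨r, hr, hle⟩
    obtain ⟨β, hβ, hlow⟩ := hlow
    by_contra! hL
    have hpos : 0 < β * L := mul_pos hβ hL
    obtain ⟨ε, h1, h2, h3, h4⟩ := ((hlow (β * L / 2) (by linarith)).and (hle.and
      ((hr.def (c := β * L / 4) (by linarith)).and
        (self_mem_nhdsWithin : ∀ᶠ ε : ℝ in 𝓝[>] 0, 0 < ε)))).exists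
    rw [Real.norm_eq_abs, Real.norm_of_nonneg (sq_nonneg ε)] at h3
    have h5 := (abs_le.1 h3).1
    have h6 : 0 < ε ^ 2 * (β * L) := by positivity
    linarith

end Asymptotics

theorem theorem1p1 {N : ℕ} (p : ℝ≥0∞) (hp : 1 ≤ p) :
    (∀ (v : EuclideanSpace ℝ (Fin N) → ℝ) (x : EuclideanSpace ℝ (Fin N)) (ε : ℝ), 0 < ε →
      ContinuousOn v (Metric.closedBall x ε) → ∃! m : ℝ, IsPMean p ε v x m) ∧
    (∀ (Ω : Set (EuclideanSpace ℝ (Fin N))), IsOpen Ω →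
      ∀ u : EuclideanSpace ℝ (Fin N) → ℝ, ContinuousOn u Ω →
        (IsViscositySolution p Ω u ↔ ∀ x ∈ Ω, ViscosityAMVP p u x)) := by
  refine ⟨fun v x ε hε hv => existsUnique_isPMean hp hε hv, fun Ω _ u _ => ?_⟩
  refine forall₂_congr fun x _ => and_congr ?_ ?_
  · refine forall₂_congr fun φ hφ => ?_
    rw [nonpos_iff_exists_isLittleO (pMean_sub_le hp hφ.contDiffAt hφ.gradient_ne_zero)
      (le_pMean_sub hp hφ.contDiffAt hφ.gradient_ne_zero)]
    refine exists_congr fun r => and_congr_right fun _ => eventually_congr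
      (Eventually.of_forall fun ε => ?_)
    rw [sub_add_eq_add_sub, sub_nonpos]
  · -- The case of touching from above, with all signs reversed.
    refine forall₂_congr fun φ hφ => ?_
    obtain ⟨β, hβ, hup⟩ := pMean_sub_le hp hφ.contDiffAt hφ.gradient_ne_zero
    obtain ⟨β', hβ', hlow⟩ := le_pMean_sub hp hφ.contDiffAt hφ.gradient_ne_zero
    rw [← neg_nonpos, nonpos_iff_exists_isLittleO (m := fun ε => φ x - pMean p ε φ x)
      ⟨β', hβ', fun δ hδ => (hlow δ hδ).mono fun ε h => by linarith⟩
      ⟨β, hβ, fun δ hδ => (hup δ hδ).mono fun ε h => by linarith⟩]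
    constructor
    · rintro ⟨r, hr, h⟩
      exact ⟨fun ε => -r ε, hr.neg_left, h.mono fun ε h => by linarith⟩
    · rintro ⟨r, hr, h⟩
      exact ⟨fun ε => -r ε, hr.neg_left, h.mono fun ε h => by linarith⟩
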